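/- Notation. Let $\alpha,\beta>-1$ and let $N\ge 1$ be an integer. $\mathcal P_N$ is the space of real polynomials of degree at most $N$; $P_n^{(a,b)}$ is the Jacobi polynomial in Szegő's normalization, $$P_n^{(a,b)}(x)=\frac1{n!}\sum_{k=0}^n\binom nk (n+a+b+1)_k\,(a+k+1)_{n-k}\Big(\frac{x-1}2\Big)^k ,$$ where $(c)_k=c(c+1)\cdots(c+k-1)$; $P_n=P_n^{(0,0)}$ is the Legendre polynomial; $\omega^{(a,b)}(x)=(1-x)^a(1+x)^b$; and, for $a,b>-1$, $$\gamma_n^{(a,b)}=\frac{2^{a+b+1}\Gamma(n+a+1)\Gamma(n+b+1)}{(2n+a+b+1)\,n!\,\Gamma(n+a+b+1)},$$ where for $n=0$ the product $(a+b+1)\Gamma(a+b+1)$ is read as $\Gamma(a+b+2)$. The connection coefficients are $${}^{(\alpha,\beta)}C_{ln}^{(a,b)}=\frac1{\gamma_l^{(a,b)}}\int_{-1}^1P_l^{(a,b)}(x)P_n^{(\alpha,\beta)}(x)\,\omega^{(a,b)}(x)\,dx .$$ Let $-1=x_0<x_1<\dots<x_N=1$ be the Jacobi–Gauss–Lobatto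 (JGL) nodes, i.e. the zeros of $(1-x^2)\frac{d}{dx}P_N^{(\alpha,\beta)}(x)$, and let $\omega_j=\int_{-1}^1h_j(x)\,\omega^{(\alpha,\beta)}(x)\,dx$ be the JGL quadrature weights, where $h_0,\dots,h_N\in\mathcal P_N$ are the Lagrange basis polynomials of the nodes. For $\mu\in(k-1,k)$, $k\in\{1,2\}$, the Caputo derivative is $${}^C\!D_-^\mu u(x)=\frac1{\Gamma(k-\mu)}\int_{-1}^x\frac{u^{(k)}(y)}{(x-y)^{\mu-k+1}}\,dy .$$ The Caputo fractional Birkhoff basis of order $\mu$ consists of the polynomials $Q_0^\mu,\dots,Q_N^\mu\in\mathcal P_N$ such that * for $\mu\in(0,1)$: $Q_0^\mu=1$, and for $1\le j\le N$: $Q_j^\mu(-1)=0$ and ${}^C\!D_-^\mu Q_j^\mu(x_i)=\delta_{ij}$ for $1\le i\le N$; * for $\mu\in(1,2)$: $Q_0^\mu(x)=\frac{1-x}2$, $Q_N^\mu(x)=\frac{1+x}2$, and for $1\le j\le N-1$: $Q_j^\mu(\pm1)=0$ and ${}^C\!D_-^\mu Q_j^\mu(x_i)=\delta_{ij}$ for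 $1\le i\le N-1$. Theorem. In both cases there is exactly one such family $\{Q_j^\mu\}$, and it is given by the following formulas, valid for all real $x$. (i) For $\mu\in(0,1)$ and $1\le j\le N$, $$Q_j^\mu(x)=\frac1{(1+x_j)^{1-\mu}}\sum_{l=0}^{N-1}\frac{\Gamma(l-\mu+2)}{l!}\,\breve\xi_{lj}\int_{-1}^xP_l(t)\,dt,\qquad \breve\xi_{lj}=\sum_{n=l}^{N-1}{}^{(\alpha,\beta)}C_{ln}^{(\mu-1,1-\mu)}\,\xi_{nj},$$ $$\xi_{nj}=\frac1{\gamma_n^{(\alpha,\beta)}}\Big\{-\frac{c_j}{\beta+1}\,\frac{P_N^{(\alpha,\beta)}(-1)}{P_N^{(\alpha,\beta)}(x_j)}\,P_n^{(\alpha,\beta)}(-1)\,\omega_0+P_n^{(\alpha,\beta)}(x_j)\,\omega_j\Big\},$$ with $c_j=1$ for $1\le j\le N-1$ and $c_N=\alpha+1$. (ii) For $\mu\in(1,2)$ and $1\le j\le N-1$, $$Q_j^\mu(x)=\frac1{(1+x_j)^{2-\mu}}\sum_{l=0}^{N-2}\frac{\Gamma(l-\mu+3)}{l!}\,\breve\xi_{lj}\,\Phi_l(x),\qquad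 \breve\xi_{lj}=\sum_{n=l}^{N-2}{}^{(\alpha,\beta)}C_{ln}^{(\mu-2,2-\mu)}\,\xi_{nj},$$ $$\xi_{nj}=\frac1{\gamma_n^{(\alpha,\beta)}}\Big\{\frac{(x_j-1)P_N^{(\alpha,\beta)}(-1)}{2(\beta+1)P_N^{(\alpha,\beta)}(x_j)}P_n^{(\alpha,\beta)}(-1)\,\omega_0-\frac{(1+x_j)P_N^{(\alpha,\beta)}(1)}{2(\alpha+1)P_N^{(\alpha,\beta)}(x_j)}P_n^{(\alpha,\beta)}(1)\,\omega_N+P_n^{(\alpha,\beta)}(x_j)\,\omega_j\Big\},$$ $$\Phi_l(x)=\frac{1+x}2\int_{-1}^1(t-1)P_l(t)\,dt+\int_{-1}^x(x-t)P_l(t)\,dt .$$ -/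

import Mathlib

open Polynomial

noncomputable section

/-- The Jacobi polynomial `P_n^{(α,β)}` in Szegő's normalization,
`(1/n!) ∑_k (n choose k) (n+α+β+1)_k (α+k+1)_{n-k} ((x-1)/2)^k`, with `(a)_k` the rising factorial.
Where `Γ(α+1)` and `(α+1)_k` make sense, this is
`Γ(n+α+1)/(n! Γ(α+1)) · ₂F₁(-n, n+α+β+1; α+1; (1-x)/2)`. -/
def jacobiPoly (α β : ℝ) (n : ℕ) : ℝ[X] :=
  ∑ k ∈ Finset.range (n + 1),
    C ((n.choose k : ℝ) * (ascPochhammer ℝ k).eval (n + α + β + 1)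
        * (ascPochhammer ℝ (n - k)).eval (α + k + 1) / (n.factorial : ℝ))
      * (C (1 / 2) * (X - 1)) ^ k

/-- The Legendre polynomial `P_n = P_n^{(0,0)}`. -/
def legendrePoly (n : ℕ) : ℝ[X] := jacobiPoly 0 0 n

/-- The Jacobi weight `ω^{(α,β)}(t) = (1-t)^α (1+t)^β` on `(-1,1)`. -/
def jacobiWeight (α β t : ℝ) : ℝ := (1 - t) ^ α * (1 + t) ^ β

/-- The normalization constant `γ_n^{(α,β)}` of the Jacobi polynomials, `α, β > -1`. For `n = 0` the
product `(α+β+1) Γ(α+β+1)` in the denominator is written as `Γ(α+β+2)`, its continuous extension to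
`α+β = -1`. -/
def jacobiGamma (α β : ℝ) (n : ℕ) : ℝ :=
  if n = 0 then
    2 ^ (α + β + 1) * Real.Gamma (α + 1) * Real.Gamma (β + 1) / Real.Gamma (α + β + 2)
  else
    2 ^ (α + β + 1) * Real.Gamma (n + α + 1) * Real.Gamma (n + β + 1)
      / ((2 * n + α + β + 1) * (n.factorial : ℝ) * Real.Gamma (n + α + β + 1))

/-- The connection coefficient of `P_l^{(a,b)}` in the expansion of `P_n^{(α,β)}`. -/
def connectionCoeff (α β a b : ℝ) (l n : ℕ) : ℝ :=
  1 / jacobiGamma a b l *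
    ∫ t in (-1 : ℝ)..1,
      (jacobiPoly a b l).eval t * (jacobiPoly α β n).eval t * jacobiWeight a b t

/-- `x 0 < x 1 < ⋯ < x N` are the Jacobi-Gauss-Lobatto nodes: the zeros of
`(1 - t²) (d/dt) P_N^{(α,β)}(t)` in ascending order. -/
structure IsJGLNodes (α β : ℝ) (N : ℕ) (x : Fin (N + 1) → ℝ) : Prop where
  strictMono : StrictMono x
  range_eq : Set.range x =
    {t : ℝ | (1 - t ^ 2) * (derivative (jacobiPoly α β N)).eval t = 0}

/-- The weights of the interpolatory quadrature rule with nodes `x 0, …, x N` for the Jacobi weight: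
the integrals of the Lagrange basis polynomials. At the Jacobi-Gauss-Lobatto nodes these are the
Jacobi-Gauss-Lobatto weights. -/
def quadWeight (α β : ℝ) {N : ℕ} (x : Fin (N + 1) → ℝ) (j : Fin (N + 1)) : ℝ :=
  ∫ t in (-1 : ℝ)..1, (Lagrange.basis Finset.univ x j).eval t * jacobiWeight α β t

/-- The left-sided fractional integral of order `ρ > 0` with base point `-1`. -/
def leftFracIntegral (ρ : ℝ) (u : ℝ → ℝ) (t : ℝ) : ℝ :=
  1 / Real.Gamma ρ * ∫ y in (-1 : ℝ)..t, u y / (t - y) ^ (1 - ρ)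

/-- The left-sided Caputo fractional derivative with base point `-1` of order `μ ∈ (k-1,k)`. -/
def caputoDeriv (k : ℕ) (μ : ℝ) (u : ℝ → ℝ) (t : ℝ) : ℝ :=
  leftFracIntegral (k - μ) (iteratedDeriv k u) t

/-- `Q 0, …, Q N` are the Caputo fractional Birkhoff interpolating basis polynomials of order
`μ ∈ (0,1)` for the points `-1 = x 0 < ⋯ < x N = 1`. -/
structure IsCaputoBirkhoffBasisOne (μ : ℝ) {N : ℕ} (x : Fin (N + 1) → ℝ)
    (Q : Fin (N + 1) → ℝ[X]) : Prop where
  degree_le : ∀ j, (Q j).natDegree ≤ N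
  zero_eq : Q 0 = 1
  eval_neg_one : ∀ j, j ≠ 0 → (Q j).eval (-1) = 0
  caputo_eq : ∀ j, j ≠ 0 → ∀ i, i ≠ 0 →
    caputoDeriv 1 μ (fun t => (Q j).eval t) (x i) = if i = j then 1 else 0

/-- `Q 0, …, Q N` are the Caputo fractional Birkhoff interpolating basis polynomials of order
`μ ∈ (1,2)` for the points `-1 = x 0 < ⋯ < x N = 1`. -/
structure IsCaputoBirkhoffBasisTwo (μ : ℝ) {N : ℕ} (x : Fin (N + 1) → ℝ)
    (Q : Fin (N + 1) → ℝ[X]) : Prop where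
  degree_le : ∀ j, (Q j).natDegree ≤ N
  zero_eq : Q 0 = C (1 / 2) * (1 - X)
  last_eq : Q (Fin.last N) = C (1 / 2) * (1 + X)
  eval_neg_one : ∀ j, j ≠ 0 → j ≠ Fin.last N → (Q j).eval (-1) = 0
  eval_one : ∀ j, j ≠ 0 → j ≠ Fin.last N → (Q j).eval 1 = 0
  caputo_eq : ∀ j, j ≠ 0 → j ≠ Fin.last N → ∀ i, i ≠ 0 → i ≠ Fin.last N →
    caputoDeriv 2 μ (fun t => (Q j).eval t) (x i) = if i = j then 1 else 0

/-- The coefficients `ξ_{nj}` for `μ ∈ (0,1)`. -/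
def xiOne (α β : ℝ) {N : ℕ} (x : Fin (N + 1) → ℝ) (n : ℕ) (j : Fin (N + 1)) : ℝ :=
  1 / jacobiGamma α β n *
    (-((if j = Fin.last N then α + 1 else 1) / (β + 1))
        * ((jacobiPoly α β N).eval (-1) / (jacobiPoly α β N).eval (x j))
        * (jacobiPoly α β n).eval (-1) * quadWeight α β x 0
      + (jacobiPoly α β n).eval (x j) * quadWeight α β x j)

/-- The coefficients of the expansion in `P_l^{(μ-1,1-μ)}` for `μ ∈ (0,1)`. -/
def xiBreveOne (α β μ : ℝ) {N : ℕ} (x : Fin (N + 1) → ℝ) (l : ℕ) (j : Fin (N + 1)) : ℝ :=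
  ∑ n ∈ Finset.Icc l (N - 1), connectionCoeff α β (μ - 1) (1 - μ) l n * xiOne α β x n j

/-- The coefficients `ξ_{nj}` for `μ ∈ (1,2)`. -/
def xiTwo (α β : ℝ) {N : ℕ} (x : Fin (N + 1) → ℝ) (n : ℕ) (j : Fin (N + 1)) : ℝ :=
  1 / jacobiGamma α β n *
    ((x j - 1) * (jacobiPoly α β N).eval (-1)
        / (2 * (β + 1) * (jacobiPoly α β N).eval (x j))
        * (jacobiPoly α β n).eval (-1) * quadWeight α β x 0
      - (1 + x j) * (jacobiPoly α β N).eval 1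
        / (2 * (α + 1) * (jacobiPoly α β N).eval (x j))
        * (jacobiPoly α β n).eval 1 * quadWeight α β x (Fin.last N)
      + (jacobiPoly α β n).eval (x j) * quadWeight α β x j)

/-- The coefficients of the expansion in `P_l^{(μ-2,2-μ)}` for `μ ∈ (1,2)`. -/
def xiBreveTwo (α β μ : ℝ) {N : ℕ} (x : Fin (N + 1) → ℝ) (l : ℕ) (j : Fin (N + 1)) : ℝ :=
  ∑ n ∈ Finset.Icc l (N - 2), connectionCoeff α β (μ - 2) (2 - μ) l n * xiTwo α β x n j

/-- The functions `Φ_l`. -/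
def phiBasis (l : ℕ) (s : ℝ) : ℝ :=
  (1 + s) / 2 * (∫ t in (-1 : ℝ)..1, (t - 1) * (legendrePoly l).eval t)
    + ∫ t in (-1 : ℝ)..s, (s - t) * (legendrePoly l).eval t

end

/-! Put `ρ = k - μ`, which lies in `(0,1)`. The Caputo derivative of `q` is the fractional integral
of order `ρ` of `q^(k)`, and that integral sends the Legendre polynomial `P_l` to `(1+t)^ρ ·
l!/Γ(l+1+ρ) · P_l^{(-ρ,ρ)}` (`leftFracIntegral_legendrePoly`). It therefore maps the polynomials of
degree `< m` bijectively onto `(1+t)^ρ` times the polynomials of degree `< m`. The Birkhoff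
conditions become Lagrange interpolation at the `m` nodes where the derivative is prescribed: the
polynomial factor must be `L_j/(1+x_j)^ρ`, where `L_j` is the cardinal polynomial of the nodes
without `-1` (`k = 1`) or without `±1` (`k = 2`). This determines `q^(k)`
(`leftFracIntegral_eq_ite_iff`), and the boundary values then determine `q`; existence and
uniqueness follow.

For the explicit coefficients, `L_j` is expanded in `P_n^{(α,β)}` and converted to `P_l^{(-ρ,ρ)}` by
connection coefficients (`sum_connectionCoeff_mul`). Its `(α,β)`-coefficients are integrals that
Gauss–Lobatto quadrature evaluates exactly (`IsJGLNodes.jacobiIntegral_eq_sum`). In that sum only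
`x_j` and the omitted endpoints contribute, and the values of `L_j` at the endpoints come from the
Jacobi differential equation (`IsJGLNodes.eval_basis_erase_zero`, `IsJGLNodes.eval_basis_interior`).
-/

/-! ### Jacobi polynomials: differential equation, derivative, reflection. -/

/-- The coefficient of `((x-1)/2)^k` in `P_n^{(a,b)}`. -/
noncomputable def jacobiCoeff (a b : ℝ) (n k : ℕ) : ℝ :=
  (n.choose k : ℝ) * (ascPochhammer ℝ k).eval (n + a + b + 1)
    * (ascPochhammer ℝ (n - k)).eval (a + k + 1) / (n.factorial : ℝ)

/-- `P_n^{(a,b)}` as a polynomial in `(x-1)/2`. -/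
noncomputable def jacobiShifted (a b : ℝ) (n : ℕ) : ℝ[X] :=
  ∑ k ∈ Finset.range (n + 1), monomial k (jacobiCoeff a b n k)

/-- The Jacobi differential operator `(1-x²) p'' + (b - a - (a+b+2) x) p'`. -/
noncomputable def jacobiOp (a b : ℝ) (p : ℝ[X]) : ℝ[X] :=
  (1 - X ^ 2) * derivative (derivative p) + (C (b - a) - C (a + b + 2) * X) * derivative p

theorem ascPochhammer_eval_succ_left (k : ℕ) (c : ℝ) :
    (ascPochhammer ℝ (k + 1)).eval c = c * (ascPochhammer ℝ k).eval (c + 1) := by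
  rw [ascPochhammer_succ_left]; simp

theorem jacobiCoeff_eq_zero {n k : ℕ} (a b : ℝ) (h : n < k) : jacobiCoeff a b n k = 0 := by
  simp [jacobiCoeff, Nat.choose_eq_zero_of_lt h]

theorem coeff_jacobiShifted (a b : ℝ) (n k : ℕ) :
    (jacobiShifted a b n).coeff k = jacobiCoeff a b n k := by
  simp only [jacobiShifted, finsetSum_coeff, coeff_monomial, Finset.sum_ite_eq', Finset.mem_range]
  split_ifs with h
  · rfl
  · rw [jacobiCoeff_eq_zero a b (by omega)]

theorem jacobiPoly_eq_comp (a b : ℝ) (n : ℕ) :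
    jacobiPoly a b n = (jacobiShifted a b n).comp (C (1 / 2) * (X - 1)) := by
  simp only [jacobiPoly, jacobiShifted, sum_comp, monomial_comp, jacobiCoeff]

/-- The term ratio of the hypergeometric series. At `k = n` the factor `n - k` ends the series, and
beyond it all coefficients vanish. -/
theorem jacobiCoeff_recurrence (a b : ℝ) (n k : ℕ) :
    ((k : ℝ) + 1) * (k + a + 1) * jacobiCoeff a b n (k + 1)
      = (n - k) * (n + k + a + b + 1) * jacobiCoeff a b n k := by
  rcases lt_trichotomy k n with h | h | h
  · obtain ⟨m, rfl⟩ : ∃ m, n = k + m + 1 := ⟨n - k - 1, by omega⟩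
    have h1 : k + m + 1 - (k + 1) = m := by omega
    have h2 : k + m + 1 - k = m + 1 := by omega
    have h3 : ((k + m + 1).choose (k + 1) : ℝ) * (k + 1) = (k + m + 1).choose k * (m + 1) := by
      have := Nat.choose_succ_right_eq (k + m + 1) k
      rw [h2] at this
      exact_mod_cast this
    simp only [jacobiCoeff, h1, h2, ascPochhammer_eval_succ_left m, ascPochhammer_succ_eval]
    have h4 : a + ((k + 1 : ℕ) : ℝ) + 1 = a + k + 1 + 1 := by push_cast; ring
    rw [h4]
    push_cast
    generalize (ascPochhammer ℝ m).eval _ = A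
    generalize (ascPochhammer ℝ k).eval _ = B
    linear_combination (k + a + 1) * B * (↑k + ↑m + 1 + a + b + 1 + ↑k) * A
      / ((k + m + 1).factorial : ℝ) * h3
  · subst h; simp [jacobiCoeff_eq_zero a b (Nat.lt_succ_self k)]
  · simp [jacobiCoeff_eq_zero a b h, jacobiCoeff_eq_zero a b (Nat.lt_succ_of_lt h)]

/-- The hypergeometric equation in `z = (x-1)/2`; comparing coefficients of `z^k` gives exactly the
recurrence. -/
theorem jacobiShifted_ode (a b : ℝ) (n : ℕ) :
    X * (1 + X) * derivative (derivative (jacobiShifted a b n))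
      + (C (a + 1) + C (a + b + 2) * X) * derivative (jacobiShifted a b n)
      = C ((n : ℝ) * (n + a + b + 1)) * jacobiShifted a b n := by
  ext k
  have key := jacobiCoeff_recurrence a b n k
  have e : X * (1 + X) * derivative (derivative (jacobiShifted a b n))
      + (C (a + 1) + C (a + b + 2) * X) * derivative (jacobiShifted a b n)
      = X * derivative (derivative (jacobiShifted a b n))
        + X * (X * derivative (derivative (jacobiShifted a b n)))
        + C (a + 1) * derivative (jacobiShifted a b n)
        + C (a + b + 2) * (X * derivative (jacobiShifted a b n)) := by ring
  rw [e]
  rcases k with _ | _ | k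
  · simp [coeff_derivative, coeff_jacobiShifted] at key ⊢
    linear_combination key
  · simp only [coeff_add, coeff_C_mul, coeff_X_mul, coeff_X_mul_zero, coeff_derivative, coeff_jacobiShifted]
    push_cast at key ⊢
    linear_combination key
  · simp only [coeff_add, coeff_C_mul, coeff_X_mul, coeff_derivative, coeff_jacobiShifted]
    push_cast at key ⊢
    linear_combination key

/-- Substitute `z = (x-1)/2` in the hypergeometric equation; each derivative contributes a factor
`1/2`. -/
theorem jacobiOp_jacobiPoly (a b : ℝ) (n : ℕ) :
    jacobiOp a b (jacobiPoly a b n) = C (-((n : ℝ) * (n + a + b + 1))) * jacobiPoly a b n := by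
  have h := congrArg (fun p => p.comp (C (1 / 2) * (X - 1))) (jacobiShifted_ode a b n)
  simp only [mul_comp, add_comp, X_comp, one_comp, C_comp] at h
  rw [jacobiOp, jacobiPoly_eq_comp]
  simp only [derivative_comp, derivative_mul, derivative_C, derivative_sub, derivative_X,
    derivative_one, zero_mul, zero_add, sub_zero, mul_one]
  generalize (derivative (derivative (jacobiShifted a b n))).comp _ = A at *
  generalize (derivative (jacobiShifted a b n)).comp _ = B at *
  generalize (jacobiShifted a b n).comp _ = D at *
  have h2 : (C (1 / 2) : ℝ[X]) * 2 = 1 := by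
    rw [show (2 : ℝ[X]) = C 2 from rfl, ← C_mul]; norm_num
  simp only [C_add, C_sub, C_neg, map_mul, map_one, map_ofNat] at h ⊢
  set u : ℝ[X] := C (1 / 2)
  linear_combination -h - ((X - 1) * u * A + (C a + 1) * B) * h2

/-- In the monomial basis the operator is triangular with diagonal `-k(k+a+b+1)`, so an eigenvalue
reveals the degree of its eigenvector. -/
theorem coeff_jacobiOp (a b : ℝ) (p : ℝ[X]) (k : ℕ) :
    (jacobiOp a b p).coeff k = (k + 2) * (k + 1) * p.coeff (k + 2)
      + (b - a) * (k + 1) * p.coeff (k + 1) - k * (k + a + b + 1) * p.coeff k := by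
  have e : jacobiOp a b p = derivative (derivative p) - X * (X * derivative (derivative p))
      + C (b - a) * derivative p - C (a + b + 2) * (X * derivative p) := by
    rw [jacobiOp]; ring
  rw [e]
  rcases k with _ | _ | k
  · simp [coeff_derivative]; ring
  · simp only [coeff_add, coeff_sub, coeff_C_mul, coeff_X_mul, coeff_X_mul_zero, coeff_derivative]
    push_cast
    ring
  · simp only [coeff_add, coeff_sub, coeff_C_mul, coeff_X_mul, coeff_derivative]
    push_cast
    ring

theorem natDegree_jacobiPoly_le (a b : ℝ) (n : ℕ) : (jacobiPoly a b n).natDegree ≤ n := by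
  refine natDegree_sum_le_of_forall_le _ _ fun k hk => ?_
  have : k ≤ n := by simpa [Nat.lt_succ_iff] using hk
  compute_degree!

theorem coeff_jacobiPoly_self (a b : ℝ) (n : ℕ) : (jacobiPoly a b n).coeff n
    = (ascPochhammer ℝ n).eval (n + a + b + 1) / (n.factorial : ℝ) * (1 / 2) ^ n := by
  rw [jacobiPoly, finsetSum_coeff, Finset.sum_range_succ, Finset.sum_eq_zero, zero_add]
  · have h : ((X - 1 : ℝ[X]) ^ n).coeff n = 1 := by
      have := (monic_X_sub_C (1 : ℝ)).pow n
      have h2 : ((X - C 1 : ℝ[X]) ^ n).natDegree = n := by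
        rw [natDegree_pow, natDegree_X_sub_C, mul_one]
      rw [Monic, leadingCoeff, h2] at this
      simpa using this
    rw [mul_pow, ← C_pow, coeff_C_mul, coeff_C_mul, h]
    simp
  · intro k hk
    apply coeff_eq_zero_of_natDegree_lt
    have hk : k < n := by simpa using hk
    refine lt_of_le_of_lt ?_ hk
    compute_degree!

theorem coeff_jacobiPoly_self_pos {a b : ℝ} (ha : -1 < a) (hb : -1 < b) (n : ℕ) :
    0 < (jacobiPoly a b n).coeff n := by
  rw [coeff_jacobiPoly_self]
  rcases n with _ | n
  · simp
  · have := ascPochhammer_pos (n + 1) (((n + 1 : ℕ) : ℝ) + a + b + 1) (by push_cast; linarith [n.cast_nonneg (α := ℝ)])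
    positivity

/-- The parameter shift behind the norm induction and the orthogonality of derivatives. -/
theorem derivative_jacobiPoly (a b : ℝ) (n : ℕ) : derivative (jacobiPoly a b (n + 1))
    = C ((n + a + b + 2) / 2) * jacobiPoly (a + 1) (b + 1) n := by
  have h : derivative (jacobiShifted a b (n + 1))
      = C (n + a + b + 2) * jacobiShifted (a + 1) (b + 1) n := by
    ext k
    rw [coeff_derivative, coeff_C_mul, coeff_jacobiShifted, coeff_jacobiShifted]
    have h3 : ((n + 1).choose (k + 1) : ℝ) * (k + 1) = (n + 1) * n.choose k := by
      exact_mod_cast (Nat.add_one_mul_choose_eq n k).symm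
    simp only [jacobiCoeff, ascPochhammer_eval_succ_left k, Nat.add_sub_add_right,
      Nat.factorial_succ]
    have e1 : ((n + 1 : ℕ) : ℝ) + a + b + 1 + 1 = n + (a + 1) + (b + 1) + 1 := by push_cast; ring
    have e2 : a + ((k + 1 : ℕ) : ℝ) + 1 = a + 1 + k + 1 := by push_cast; ring
    rw [e1, e2]
    push_cast
    generalize (ascPochhammer ℝ (n - k)).eval _ = A
    generalize (ascPochhammer ℝ k).eval _ = B
    have : (n.factorial : ℝ) ≠ 0 := by positivity
    field_simp
    linear_combination (n + 1 + a + b + 1) * A * B * h3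
  rw [jacobiPoly_eq_comp, jacobiPoly_eq_comp, derivative_comp, h]
  simp only [derivative_mul, derivative_C, derivative_sub, derivative_X,
    derivative_one, zero_mul, zero_add, sub_zero, mul_one, mul_comp, C_comp]
  rw [← mul_assoc, ← C_mul]
  congr 2; ring

theorem jacobi_eigenvalue_ne {a b : ℝ} (ha : -1 < a) (hb : -1 < b) {m n : ℕ} (h : m ≠ n) :
    (m : ℝ) * (m + a + b + 1) ≠ n * (n + a + b + 1) := by
  intro e
  have h1 : ((m : ℝ) - n) * (m + n + a + b + 1) = 0 := by linear_combination e
  have h2 : (1 : ℝ) ≤ m + n := by exact_mod_cast (by omega : 1 ≤ m + n)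
  rcases mul_eq_zero.mp h1 with h1 | h1
  · exact h (by exact_mod_cast sub_eq_zero.mp h1)
  · linarith

theorem natDegree_eq_of_jacobiOp_eq {a b : ℝ} (ha : -1 < a) (hb : -1 < b) {p : ℝ[X]} {n : ℕ}
    (hp : p ≠ 0) (h : jacobiOp a b p = C (-((n : ℝ) * (n + a + b + 1))) * p) :
    p.natDegree = n := by
  by_contra hne
  have h1 := congrArg (fun q => q.coeff p.natDegree) h
  simp only [coeff_jacobiOp, coeff_C_mul] at h1
  rw [coeff_eq_zero_of_natDegree_lt (by omega : p.natDegree < p.natDegree + 2),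
    coeff_eq_zero_of_natDegree_lt (by omega : p.natDegree < p.natDegree + 1)] at h1
  have h2 : p.coeff p.natDegree ≠ 0 := leadingCoeff_ne_zero.mpr hp
  refine jacobi_eigenvalue_ne ha hb hne (mul_right_cancel₀ h2 ?_)
  linear_combination -h1

theorem jacobiOp_comp_neg_X (a b : ℝ) (p : ℝ[X]) :
    jacobiOp b a (p.comp (-X)) = (jacobiOp a b p).comp (-X) := by
  simp only [jacobiOp, derivative_comp, derivative_neg, derivative_X, derivative_mul, mul_comp,
    add_comp, sub_comp, one_comp, pow_comp, X_comp, C_comp, C_sub, C_add, derivative_one]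
  ring

theorem jacobiOp_sub (a b : ℝ) (p q : ℝ[X]) :
    jacobiOp a b (p - q) = jacobiOp a b p - jacobiOp a b q := by
  simp only [jacobiOp, derivative_sub]; ring

theorem jacobiOp_C_mul (a b c : ℝ) (p : ℝ[X]) :
    jacobiOp a b (C c * p) = C c * jacobiOp a b p := by
  simp only [jacobiOp, derivative_C_mul]; ring

/-- Both sides are eigenvectors of the operator with parameters `(b,a)` for the same eigenvalue. A
nonzero difference would have degree exactly `n`, but the coefficients of degree `n` agree. -/
theorem jacobiPoly_comp_neg_X {a b : ℝ} (ha : -1 < a) (hb : -1 < b) (n : ℕ) :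
    (jacobiPoly a b n).comp (-X) = C ((-1) ^ n) * jacobiPoly b a n := by
  rw [← sub_eq_zero]
  by_contra hne
  have h := natDegree_eq_of_jacobiOp_eq (n := n) hb ha hne (by
    rw [jacobiOp_sub, jacobiOp_comp_neg_X, jacobiOp_jacobiPoly, jacobiOp_C_mul,
      jacobiOp_jacobiPoly, mul_comp, C_comp]
    rw [show (n : ℝ) + b + a + 1 = n + a + b + 1 by ring]
    ring)
  apply hne
  rw [← leadingCoeff_eq_zero, leadingCoeff, h, coeff_sub, show (-X : ℝ[X]) = C (-1) * X by simp,
    comp_C_mul_X_coeff, coeff_C_mul,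
    coeff_jacobiPoly_self, coeff_jacobiPoly_self, show (n : ℝ) + b + a + 1 = n + a + b + 1 by ring]
  ring

/-! ### Beta integrals and integrability of the weight. -/

theorem integral_rpow_mul_sub_rpow {u v t : ℝ} (hu : 0 < u) (hv : 0 < v) (ht : -1 < t) :
    ∫ y in (-1 : ℝ)..t, (1 + y) ^ (u - 1) * (t - y) ^ (v - 1)
      = (1 + t) ^ (u + v - 1) * (Real.Gamma u * Real.Gamma v / Real.Gamma (u + v)) := by
  have hc : 0 < 1 + t := by linarith
  have h1 : ∫ y in (-1 : ℝ)..t, (1 + y) ^ (u - 1) * (t - y) ^ (v - 1)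
      = ∫ y in (0 : ℝ)..(1 + t), y ^ (u - 1) * (1 + t - y) ^ (v - 1) := by
    have := intervalIntegral.integral_comp_add_left (a := -1) (b := t)
      (fun y : ℝ => y ^ (u - 1) * (1 + t - y) ^ (v - 1)) 1
    rw [add_neg_cancel] at this
    rw [← this]
    congr 1; ext y; congr 2; ring
  have h2 := Complex.betaIntegral_scaled u v hc
  rw [Complex.betaIntegral_eq_Gamma_mul_div _ _ (by simpa) (by simpa)] at h2
  rw [h1]
  apply Complex.ofReal_injective
  rw [← intervalIntegral.integral_ofReal]
  push_cast
  rw [Complex.ofReal_cpow hc.le, ← Complex.Gamma_ofReal, ← Complex.Gamma_ofReal,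
    ← Complex.Gamma_ofReal]
  push_cast at h2 ⊢
  rw [← h2]
  apply intervalIntegral.integral_congr
  intro y hy
  rw [Set.uIcc_of_le hc.le] at hy
  simp only
  rw [Complex.ofReal_cpow hy.1, Complex.ofReal_cpow (by linarith [hy.2])]
  push_cast
  rfl

theorem intervalIntegrable_rpow_mul_sub_rpow {b v t : ℝ} (hb : -1 < b) (hv : -1 < v) (ht : -1 < t) :
    IntervalIntegrable (fun y : ℝ => (1 + y) ^ b * (t - y) ^ v) MeasureTheory.volume (-1) t := by
  have hm1 : -1 < (t - 1) / 2 := by linarith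
  have hm2 : (t - 1) / 2 < t := by linarith
  -- Splitting at the midpoint leaves one possibly singular factor on each half.
  refine IntervalIntegrable.trans (b := (t - 1) / 2) ?_ ?_
  · refine IntervalIntegrable.mul_continuousOn ?_ ?_
    · have := (intervalIntegral.intervalIntegrable_rpow' (a := 0) (b := (1 + t) / 2) hb).comp_add_left 1
      convert this using 1 <;> ring
    · intro y hy
      rw [Set.uIcc_of_le hm1.le] at hy
      have : t - y ≠ 0 := by linarith [hy.2]
      exact (ContinuousAt.rpow_const (by fun_prop) (Or.inl this)).continuousWithinAt
  · refine IntervalIntegrable.continuousOn_mul ?_ ?_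
    · have := (intervalIntegral.intervalIntegrable_rpow' (a := (1 + t) / 2) (b := 0) hv).comp_sub_left t
      convert this using 1 <;> ring
    · intro y hy
      rw [Set.uIcc_of_le hm2.le] at hy
      have : 1 + y ≠ 0 := by linarith [hy.1]
      exact (ContinuousAt.rpow_const (by fun_prop) (Or.inl this)).continuousWithinAt

theorem intervalIntegrable_eval_mul_jacobiWeight {a b : ℝ} (ha : -1 < a) (hb : -1 < b)
    (f : ℝ[X]) : IntervalIntegrable (fun t => f.eval t * jacobiWeight a b t)
      MeasureTheory.volume (-1) 1 := by
  refine IntervalIntegrable.continuousOn_mul ?_ f.continuous.continuousOn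
  have := intervalIntegrable_rpow_mul_sub_rpow hb ha (t := 1) (by norm_num)
  refine this.congr fun t _ => ?_
  simp only [jacobiWeight, mul_comm]

/-! ### Orthogonality and norms of Jacobi polynomials. -/

/-- Integration of polynomials against the Jacobi weight. -/
noncomputable def jacobiIntegral {a b : ℝ} (ha : -1 < a) (hb : -1 < b) : ℝ[X] →ₗ[ℝ] ℝ where
  toFun f := ∫ t in (-1 : ℝ)..1, f.eval t * jacobiWeight a b t
  map_add' f g := by
    simp only [eval_add, add_mul]
    exact intervalIntegral.integral_add (intervalIntegrable_eval_mul_jacobiWeight ha hb f)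
      (intervalIntegrable_eval_mul_jacobiWeight ha hb g)
  map_smul' c f := by
    simp only [eval_smul, smul_eq_mul, mul_assoc, RingHom.id_apply]
    exact intervalIntegral.integral_const_mul _ _

theorem jacobiIntegral_apply {a b : ℝ} (ha : -1 < a) (hb : -1 < b) (f : ℝ[X]) :
    jacobiIntegral ha hb f = ∫ t in (-1 : ℝ)..1, f.eval t * jacobiWeight a b t := rfl

theorem jacobiIntegral_C_mul {a b : ℝ} (ha : -1 < a) (hb : -1 < b) (c : ℝ) (f : ℝ[X]) :
    jacobiIntegral ha hb (C c * f) = c * jacobiIntegral ha hb f := by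
  rw [C_mul', map_smul, smul_eq_mul]

theorem jacobiWeight_add_one {a b t : ℝ} (ha : -1 < a) (hb : -1 < b) (ht : t ∈ Set.Icc (-1 : ℝ) 1) :
    jacobiWeight (a + 1) (b + 1) t = (1 - t ^ 2) * jacobiWeight a b t := by
  rw [jacobiWeight, jacobiWeight, Real.rpow_add_one' (by linarith [ht.2]) (by linarith),
    Real.rpow_add_one' (by linarith [ht.1]) (by linarith)]
  ring

theorem neg_one_lt_add_one {a : ℝ} (ha : -1 < a) : -1 < a + 1 := by linarith

/-- Raising both parameters absorbs the factor `1 - X²` that integration by parts produces. -/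
theorem jacobiIntegral_add_one {a b : ℝ} (ha : -1 < a) (hb : -1 < b) (f : ℝ[X]) :
    jacobiIntegral (neg_one_lt_add_one ha) (neg_one_lt_add_one hb) f
      = jacobiIntegral ha hb ((1 - X ^ 2) * f) := by
  rw [jacobiIntegral_apply, jacobiIntegral_apply]
  apply intervalIntegral.integral_congr
  intro t ht
  rw [Set.uIcc_of_le (by norm_num)] at ht
  simp only [jacobiWeight_add_one ha hb ht, eval_mul, eval_sub, eval_one, eval_pow, eval_X]
  ring

/-- The divergence identity `∫ ((1-t²) ω f)' = 0` for the Jacobi weight `ω`. -/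
theorem jacobiIntegral_divergence {a b : ℝ} (ha : -1 < a) (hb : -1 < b) (f : ℝ[X]) :
    jacobiIntegral ha hb
      ((1 - X ^ 2) * derivative f + (C (b - a) - C (a + b + 2) * X) * f) = 0 := by
  rw [jacobiIntegral_apply]
  have ha' : 0 < a + 1 := by linarith
  have hb' : 0 < b + 1 := by linarith
  -- The primitive carries the exponents `a+1, b+1 > 0`, so it is continuous on `[-1,1]` and
  -- vanishes at both ends, even where the weight itself is singular.
  rw [intervalIntegral.integral_eq_sub_of_hasDerivAt_of_le (by norm_num)
    (f := fun t => jacobiWeight (a + 1) (b + 1) t * f.eval t) ?_ ?_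
    (intervalIntegrable_eval_mul_jacobiWeight ha hb _)]
  · simp [jacobiWeight, Real.zero_rpow ha'.ne', Real.zero_rpow hb'.ne']
  · refine ContinuousOn.mul (ContinuousOn.mul ?_ ?_) f.continuous.continuousOn
    · exact (Continuous.rpow_const (by fun_prop) fun _ => Or.inr ha'.le).continuousOn
    · exact (Continuous.rpow_const (by fun_prop) fun _ => Or.inr hb'.le).continuousOn
  · intro t ht
    have h1 : 0 < 1 - t := by linarith [ht.2]
    have h2 : 0 < 1 + t := by linarith [ht.1]
    have d1 : HasDerivAt (fun t : ℝ => (1 - t) ^ (a + 1)) _ t :=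
      ((hasDerivAt_id t).const_sub 1).rpow_const (Or.inl h1.ne')
    have d2 : HasDerivAt (fun t : ℝ => (1 + t) ^ (b + 1)) _ t :=
      ((hasDerivAt_id t).const_add 1).rpow_const (Or.inl h2.ne')
    refine ((d1.mul d2).mul (f.hasDerivAt t)).congr_deriv ?_
    simp only [add_sub_cancel_right, id, Pi.mul_apply, eval_add, eval_mul, eval_sub, eval_one,
      eval_pow, eval_X, eval_C, jacobiWeight]
    rw [Real.rpow_add_one h1.ne', Real.rpow_add_one h2.ne']
    ring

/-- Integration by parts: the divergence identity for `p' q`. The right-hand side is symmetric in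
`p` and `q`, which makes the operator self-adjoint. -/
theorem jacobiIntegral_jacobiOp_mul {a b : ℝ} (ha : -1 < a) (hb : -1 < b) (p q : ℝ[X]) :
    jacobiIntegral ha hb (jacobiOp a b p * q)
      = -jacobiIntegral ha hb ((1 - X ^ 2) * (derivative p * derivative q)) := by
  rw [eq_neg_iff_add_eq_zero, ← map_add, ← jacobiIntegral_divergence ha hb (derivative p * q)]
  congr 1
  rw [jacobiOp, derivative_mul]
  ring

theorem jacobiIntegral_jacobiPoly_mul_derivative {a b : ℝ} (ha : -1 < a) (hb : -1 < b) (n : ℕ)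
    (q : ℝ[X]) : jacobiIntegral ha hb
      ((1 - X ^ 2) * (derivative (jacobiPoly a b n) * derivative q))
      = n * (n + a + b + 1) * jacobiIntegral ha hb (jacobiPoly a b n * q) := by
  have := jacobiIntegral_jacobiOp_mul ha hb (jacobiPoly a b n) q
  rw [jacobiOp_jacobiPoly, mul_assoc, jacobiIntegral_C_mul] at this
  linarith

theorem jacobiIntegral_jacobiPoly_mul_of_ne {a b : ℝ} (ha : -1 < a) (hb : -1 < b) {m n : ℕ}
    (h : m ≠ n) : jacobiIntegral ha hb (jacobiPoly a b m * jacobiPoly a b n) = 0 := by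
  have h1 := jacobiIntegral_jacobiPoly_mul_derivative ha hb m (jacobiPoly a b n)
  have h2 := jacobiIntegral_jacobiPoly_mul_derivative ha hb n (jacobiPoly a b m)
  rw [mul_comm (derivative _) (derivative _), mul_comm (jacobiPoly a b n)] at h2
  have h3 := sub_ne_zero.mpr (jacobi_eigenvalue_ne ha hb h)
  refine (mul_eq_zero.mp ?_).resolve_left h3
  linear_combination h2 - h1

theorem jacobiGamma_pos {a b : ℝ} (ha : -1 < a) (hb : -1 < b) (n : ℕ) : 0 < jacobiGamma a b n := by
  have hn : (0 : ℝ) ≤ n := n.cast_nonneg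
  have h1 := Real.Gamma_pos_of_pos (by linarith : 0 < n + a + 1)
  have h2 := Real.Gamma_pos_of_pos (by linarith : 0 < n + b + 1)
  rw [jacobiGamma]
  split_ifs with h
  · subst h
    have h3 := Real.Gamma_pos_of_pos (by linarith : 0 < a + b + 2)
    rw [Nat.cast_zero, zero_add] at h1 h2
    positivity
  · have hn1 : (1 : ℝ) ≤ n := by exact_mod_cast Nat.one_le_iff_ne_zero.mpr h
    have h3 := Real.Gamma_pos_of_pos (by linarith : 0 < n + a + b + 1)
    have h4 : 0 < 2 * n + a + b + 1 := by linarith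
    positivity

theorem jacobiPoly_zero (a b : ℝ) : jacobiPoly a b 0 = 1 := by simp [jacobiPoly]

/-- The relation between norms that differentiation forces. The case `n = 0` on the right is
separate because of the convention in `jacobiGamma`. -/
theorem jacobiGamma_succ {a b : ℝ} (ha : -1 < a) (hb : -1 < b) (n : ℕ) :
    4 * (n + 1) * jacobiGamma a b (n + 1)
      = (n + a + b + 2) * jacobiGamma (a + 1) (b + 1) n := by
  have hn : (0 : ℝ) ≤ n := n.cast_nonneg
  have h0 : 0 < n + a + b + 2 := by linarith
  have h2 : (2 : ℝ) ^ (a + 1 + (b + 1) + 1) = 4 * 2 ^ (a + b + 1) := by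
    rw [show a + 1 + (b + 1) + 1 = a + b + 1 + 2 by ring, Real.rpow_add (by norm_num)]
    norm_num; ring
  have hG : Real.Gamma (n + a + b + 3) = (n + a + b + 2) * Real.Gamma (n + a + b + 2) := by
    rw [← Real.Gamma_add_one h0.ne']; congr 1; ring
  have hGp := Real.Gamma_pos_of_pos h0
  have h5 : 0 < 2 * n + a + b + 3 := by linarith
  rw [jacobiGamma, if_neg n.succ_ne_zero, jacobiGamma]
  split_ifs with h
  · subst h
    have hG' : Real.Gamma (a + b + 4) = (a + b + 3) * Real.Gamma (a + b + 3) := by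
      rw [← Real.Gamma_add_one (by linarith)]; congr 1; ring
    simp only [CharP.cast_eq_zero, zero_add] at *
    rw [h2, show a + 1 + (b + 1) + 2 = a + b + 4 by ring, hG', hG]
    simp only [Nat.factorial_one, Nat.cast_one]
    rw [show 1 + a + b + 1 = a + b + 2 by ring, show 2 * 1 + a + b + 1 = a + b + 3 by ring,
      add_comm 1 a, add_comm 1 b]
    field_simp
  · rw [h2, Nat.factorial_succ]
    push_cast
    rw [show n + (a + 1) + (b + 1) + 1 = n + a + b + 3 by ring, hG,
      show (n : ℝ) + 1 + a + b + 1 = n + a + b + 2 by ring,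
      show 2 * n + (a + 1) + (b + 1) + 1 = 2 * n + a + b + 3 by ring,
      show 2 * ((n : ℝ) + 1) + a + b + 1 = 2 * n + a + b + 3 by ring,
      show n + (a + 1) + 1 = n + 1 + a + 1 by ring, show n + (b + 1) + 1 = n + 1 + b + 1 by ring]
    field_simp

/-- Induction on `n` for all parameters at once: integration by parts turns the norm at `n+1` into
the norm of the derivative, a multiple of `P_n^{(a+1,b+1)}`. The base case is a Beta integral. -/
theorem jacobiIntegral_jacobiPoly_mul_self (n : ℕ) : ∀ {a b : ℝ} (ha : -1 < a) (hb : -1 < b),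
    jacobiIntegral ha hb (jacobiPoly a b n * jacobiPoly a b n) = jacobiGamma a b n := by
  induction n with
  | zero =>
    intro a b ha hb
    have h := integral_rpow_mul_sub_rpow (u := b + 1) (v := a + 1) (t := 1)
      (by linarith) (by linarith) (by norm_num)
    rw [jacobiIntegral_apply, jacobiGamma, if_pos rfl]
    simp only [jacobiPoly_zero, mul_one, eval_one, one_mul, jacobiWeight]
    simp only [add_sub_cancel_right] at h
    simp_rw [mul_comm ((1 - _ : ℝ) ^ a)]
    rw [h, show b + 1 + (a + 1) - 1 = a + b + 1 by ring, show b + 1 + (a + 1) = a + b + 2 by ring]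
    norm_num
    ring
  | succ n ih =>
    intro a b ha hb
    have hn : (0 : ℝ) ≤ n := n.cast_nonneg
    have h0 : 0 < n + a + b + 2 := by linarith
    have h := jacobiIntegral_jacobiPoly_mul_derivative ha hb (n + 1) (jacobiPoly a b (n + 1))
    rw [derivative_jacobiPoly, ← jacobiIntegral_add_one, mul_mul_mul_comm, ← C_mul,
      jacobiIntegral_C_mul, ih] at h
    have h2 := jacobiGamma_succ ha hb n
    push_cast at h
    have h3 : (n + 1) * (n + a + b + 2) ≠ 0 := by positivity
    refine mul_left_cancel₀ h3 ?_
    linear_combination -h - (n + a + b + 2) / 4 * h2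

theorem jacobiIntegral_jacobiPoly_sum {a b : ℝ} (ha : -1 < a) (hb : -1 < b) {m l : ℕ} (hl : l < m)
    (c : ℕ → ℝ) : jacobiIntegral ha hb
      (jacobiPoly a b l * ∑ n ∈ Finset.range m, C (c n) * jacobiPoly a b n)
      = c l * jacobiGamma a b l := by
  rw [Finset.mul_sum, map_sum, Finset.sum_eq_single_of_mem l (Finset.mem_range.mpr hl)]
  · rw [mul_left_comm, jacobiIntegral_C_mul, jacobiIntegral_jacobiPoly_mul_self]
  · intro n _ hn
    rw [mul_left_comm, jacobiIntegral_C_mul, jacobiIntegral_jacobiPoly_mul_of_ne ha hb hn.symm,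
      mul_zero]

/-- The degree of `P_m` is exactly `m`, so the top coefficient can be removed and the induction
continues. -/
theorem exists_eq_sum_jacobiPoly {a b : ℝ} (ha : -1 < a) (hb : -1 < b) (m : ℕ) :
    ∀ f : ℝ[X], f.degree < m →
      ∃ c : ℕ → ℝ, f = ∑ n ∈ Finset.range m, C (c n) * jacobiPoly a b n := by
  induction m with
  | zero =>
    intro f hf
    exact ⟨0, by simpa using hf⟩
  | succ m ih =>
    intro f hf
    have hlead := (coeff_jacobiPoly_self_pos ha hb m).ne'
    set r := f.coeff m / (jacobiPoly a b m).coeff m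
    have hdeg : (f - C r * jacobiPoly a b m).degree < m := by
      rw [degree_lt_iff_coeff_zero]
      intro k hk
      rcases hk.eq_or_lt with rfl | hk
      · simp [r, hlead]
      · rw [coeff_sub, coeff_C_mul, coeff_eq_zero_of_natDegree_lt
          ((natDegree_jacobiPoly_le a b m).trans_lt hk), (degree_lt_iff_coeff_zero _ _).mp hf k hk]
        simp
    obtain ⟨c, hc⟩ := ih _ hdeg
    refine ⟨Function.update c m r, ?_⟩
    rw [Finset.sum_range_succ, Function.update_self, ← sub_eq_iff_eq_add, hc]
    refine Finset.sum_congr rfl fun n hn => ?_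
    rw [Function.update_of_ne (Finset.mem_range.mp hn).ne]

theorem eq_sum_jacobiPoly {a b : ℝ} (ha : -1 < a) (hb : -1 < b) {m : ℕ} {f : ℝ[X]}
    (hf : f.degree < m) : f = ∑ n ∈ Finset.range m,
      C (1 / jacobiGamma a b n * jacobiIntegral ha hb (jacobiPoly a b n * f)) * jacobiPoly a b n := by
  obtain ⟨c, hc⟩ := exists_eq_sum_jacobiPoly ha hb m f hf
  conv_lhs => rw [hc]
  refine Finset.sum_congr rfl fun n hn => ?_
  have hg := (jacobiGamma_pos ha hb n).ne'
  rw [hc, jacobiIntegral_jacobiPoly_sum ha hb (Finset.mem_range.mp hn)]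
  congr 2
  field_simp

theorem jacobiIntegral_jacobiPoly_mul_of_degree_lt {a b : ℝ} (ha : -1 < a) (hb : -1 < b) {n : ℕ}
    {q : ℝ[X]} (hq : q.degree < n) : jacobiIntegral ha hb (jacobiPoly a b n * q) = 0 := by
  obtain ⟨c, rfl⟩ := exists_eq_sum_jacobiPoly ha hb n q hq
  rw [Finset.mul_sum, map_sum]
  refine Finset.sum_eq_zero fun k hk => ?_
  rw [mul_left_comm, jacobiIntegral_C_mul,
    jacobiIntegral_jacobiPoly_mul_of_ne ha hb (Finset.mem_range.mp hk).ne', mul_zero]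

/-- `P_{n+1}'` is orthogonal to lower degrees for the weight with raised parameters. This yields
both the location of the nodes and the exactness of the quadrature. -/
theorem jacobiIntegral_derivative_jacobiPoly_mul {a b : ℝ} (ha : -1 < a) (hb : -1 < b) {n : ℕ}
    {q : ℝ[X]} (hq : q.degree < n) : jacobiIntegral ha hb
      ((1 - X ^ 2) * (derivative (jacobiPoly a b (n + 1)) * q)) = 0 := by
  rw [derivative_jacobiPoly, ← jacobiIntegral_add_one, mul_assoc, jacobiIntegral_C_mul,
    jacobiIntegral_jacobiPoly_mul_of_degree_lt _ _ hq, mul_zero]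

/-! ### Fractional integrals of Legendre polynomials. -/

theorem eval_jacobiPoly_eq_sum (a b : ℝ) (n : ℕ) (y : ℝ) : (jacobiPoly a b n).eval y
    = ∑ k ∈ Finset.range (n + 1), jacobiCoeff a b n k * ((y - 1) / 2) ^ k := by
  simp only [jacobiPoly, eval_finsetSum, jacobiCoeff, eval_mul, eval_pow, eval_C, eval_sub,
    eval_X, eval_one]
  refine Finset.sum_congr rfl fun k _ => ?_
  ring

/-- Fractional integrals based at `-1` are explicit on powers of `1+y`, so the expansion is moved to
that endpoint by reflection, which swaps the parameters. -/
theorem eval_jacobiPoly_eq_sum_one_add {a b : ℝ} (ha : -1 < a) (hb : -1 < b) (n : ℕ) (y : ℝ) :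
    (jacobiPoly a b n).eval y
      = ∑ k ∈ Finset.range (n + 1), (-1) ^ n * (-1 / 2) ^ k * jacobiCoeff b a n k * (1 + y) ^ k := by
  have h := congrArg (fun p => p.eval y) (jacobiPoly_comp_neg_X hb ha n)
  simp only [eval_comp, eval_neg, eval_X, eval_mul, eval_C] at h
  have h2 : ((-1 : ℝ) ^ n) * (-1) ^ n = 1 := by rw [← mul_pow]; simp
  have h3 : (jacobiPoly a b n).eval y = (-1) ^ n * (jacobiPoly b a n).eval (-y) := by
    rw [h, ← mul_assoc, h2, one_mul]
  rw [h3, eval_jacobiPoly_eq_sum, Finset.mul_sum]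
  refine Finset.sum_congr rfl fun k _ => ?_
  rw [show (-y - 1) / 2 = -1 / 2 * (1 + y) by ring, mul_pow]
  ring

theorem Gamma_add_nat_eq {x : ℝ} (hx : 0 < x) (m : ℕ) :
    Real.Gamma (x + m) = (ascPochhammer ℝ m).eval x * Real.Gamma x := by
  induction m with
  | zero => simp
  | succ m ih =>
    have : 0 < x + m := by positivity
    rw [ascPochhammer_succ_eval, Nat.cast_succ, ← add_assoc, Real.Gamma_add_one this.ne', ih]
    ring

theorem intervalIntegrable_div_sub_rpow {ρ t : ℝ} (hρ : 0 < ρ) (ht : -1 < t) {f : ℝ → ℝ}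
    (hf : Continuous f) : IntervalIntegrable (fun y => f y / (t - y) ^ (1 - ρ))
      MeasureTheory.volume (-1) t := by
  have h := (intervalIntegrable_rpow_mul_sub_rpow (b := 0) (v := ρ - 1) (by norm_num)
    (by linarith) ht).continuousOn_mul hf.continuousOn
  refine h.congr fun y hy => ?_
  rw [Set.uIoc_of_le ht.le] at hy
  simp only [Real.rpow_zero, one_mul]
  rw [show ρ - 1 = -(1 - ρ) by ring, Real.rpow_neg (by linarith [hy.2]), div_eq_mul_inv]

theorem leftFracIntegral_sum {ι : Type*} {ρ t : ℝ} (hρ : 0 < ρ) (ht : -1 < t) (s : Finset ι)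
    (c : ι → ℝ) {f : ι → ℝ → ℝ} (hf : ∀ i, Continuous (f i)) :
    leftFracIntegral ρ (fun y => ∑ i ∈ s, c i * f i y) t
      = ∑ i ∈ s, c i * leftFracIntegral ρ (f i) t := by
  simp only [leftFracIntegral, Finset.sum_div, mul_div_assoc]
  rw [intervalIntegral.integral_finsetSum, Finset.mul_sum]
  · refine Finset.sum_congr rfl fun i _ => ?_
    rw [intervalIntegral.integral_const_mul]
    ring
  · intro i _
    exact (intervalIntegrable_div_sub_rpow hρ ht (hf i)).const_mul _

theorem leftFracIntegral_one_add_pow {ρ t : ℝ} (hρ : 0 < ρ) (ht : -1 < t) (k : ℕ) :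
    leftFracIntegral ρ (fun y => (1 + y) ^ k) t
      = (1 + t) ^ ρ * (k.factorial / Real.Gamma (k + 1 + ρ) * (1 + t) ^ k) := by
  have h := integral_rpow_mul_sub_rpow (u := k + 1) (v := ρ) (t := t) (by positivity) hρ ht
  have h1 : ∫ y in (-1 : ℝ)..t, (1 + y) ^ k / (t - y) ^ (1 - ρ)
      = ∫ y in (-1 : ℝ)..t, (1 + y) ^ ((k : ℝ) + 1 - 1) * (t - y) ^ (ρ - 1) := by
    apply intervalIntegral.integral_congr
    intro y hy
    rw [Set.uIcc_of_le ht.le] at hy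
    simp only
    rw [add_sub_cancel_right, Real.rpow_natCast, show ρ - 1 = -(1 - ρ) by ring,
      Real.rpow_neg (by linarith [hy.2]), div_eq_mul_inv]
  have hΓ := (Real.Gamma_pos_of_pos hρ).ne'
  rw [leftFracIntegral, h1, h, Real.Gamma_nat_eq_factorial, show (k : ℝ) + 1 + ρ - 1 = ρ + k by ring,
    Real.rpow_add (by linarith), Real.rpow_natCast]
  field_simp

/-- Since `ρ + (-ρ) = 0`, the factors `(l+1)_k` coincide. What remains is `(k+1)_{l-k}` against
`(k+1+ρ)_{l-k}`, and the Gamma quotients exchange these. -/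
theorem jacobiCoeff_zero_zero_mul {ρ : ℝ} (hρ : 0 < ρ) {k l : ℕ} (hkl : k ≤ l) :
    jacobiCoeff 0 0 l k * (k.factorial / Real.Gamma (k + 1 + ρ))
      = l.factorial / Real.Gamma (l + 1 + ρ) * jacobiCoeff ρ (-ρ) l k := by
  obtain ⟨m, rfl⟩ := Nat.exists_eq_add_of_le hkl
  have hk : (0 : ℝ) < k + 1 := by positivity
  have h1 := Gamma_add_nat_eq (by positivity : 0 < (k : ℝ) + 1 + ρ) m
  have h2 := Gamma_add_nat_eq hk m
  rw [show (k : ℝ) + 1 + m = ((k + m : ℕ) : ℝ) + 1 by push_cast; ring,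
    Real.Gamma_nat_eq_factorial, Real.Gamma_nat_eq_factorial] at h2
  have e1 : ((k + m : ℕ) : ℝ) + 1 + ρ = k + 1 + ρ + m := by push_cast; ring
  have hG := (Real.Gamma_pos_of_pos (by positivity : 0 < (k : ℝ) + 1 + ρ)).ne'
  have hA := (ascPochhammer_pos m ((k : ℝ) + 1 + ρ) (by positivity)).ne'
  have hA2 := (ascPochhammer_pos m ((k : ℝ) + 1) (by positivity)).ne'
  rw [e1, h1, jacobiCoeff, jacobiCoeff, h2, Nat.add_sub_cancel_left,
    show (0 : ℝ) + k + 1 = k + 1 by ring, show ρ + k + 1 = k + 1 + ρ by ring,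
    show ((k + m : ℕ) : ℝ) + ρ + -ρ + 1 = ((k + m : ℕ) : ℝ) + 0 + 0 + 1 by ring]
  field_simp

/-- The fractional integral of a Legendre polynomial. -/
theorem leftFracIntegral_legendrePoly {ρ t : ℝ} (hρ : 0 < ρ) (hρ1 : ρ < 1) (ht : -1 < t) (l : ℕ) :
    leftFracIntegral ρ (fun y => (legendrePoly l).eval y) t
      = (1 + t) ^ ρ * (l.factorial / Real.Gamma (l + 1 + ρ) * (jacobiPoly (-ρ) ρ l).eval t) := by
  simp only [legendrePoly]
  simp_rw [eval_jacobiPoly_eq_sum_one_add (a := 0) (b := 0) (by norm_num) (by norm_num)]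
  rw [leftFracIntegral_sum hρ ht _ _ (fun k => by fun_prop),
    eval_jacobiPoly_eq_sum_one_add (by linarith) (by linarith), Finset.mul_sum, Finset.mul_sum]
  refine Finset.sum_congr rfl fun k hk => ?_
  rw [leftFracIntegral_one_add_pow hρ ht]
  linear_combination (-1) ^ l * (-1 / 2) ^ k * (1 + t) ^ ρ * (1 + t) ^ k *
    jacobiCoeff_zero_zero_mul hρ (Nat.lt_succ_iff.mp (Finset.mem_range.mp hk))

theorem leftFracIntegral_sum_legendrePoly {ρ t : ℝ} (hρ : 0 < ρ) (hρ1 : ρ < 1) (ht : -1 < t)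
    (m : ℕ) (c : ℕ → ℝ) :
    leftFracIntegral ρ (fun y => (∑ l ∈ Finset.range m, C (c l) * legendrePoly l).eval y) t
      = (1 + t) ^ ρ * (∑ l ∈ Finset.range m,
          C (c l * (l.factorial / Real.Gamma (l + 1 + ρ))) * jacobiPoly (-ρ) ρ l).eval t := by
  simp only [eval_finsetSum, eval_mul, eval_C]
  rw [leftFracIntegral_sum hρ ht _ _ (fun l => (legendrePoly l).continuous), Finset.mul_sum]
  refine Finset.sum_congr rfl fun l _ => ?_
  rw [leftFracIntegral_legendrePoly hρ hρ1 ht]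
  ring

theorem degree_sum_C_mul_jacobiPoly_lt (a b : ℝ) (m : ℕ) (c : ℕ → ℝ) :
    (∑ l ∈ Finset.range m, C (c l) * jacobiPoly a b l).degree < m := by
  refine (degree_lt_iff_coeff_zero _ _).mpr fun k hk => ?_
  rw [finsetSum_coeff]
  refine Finset.sum_eq_zero fun l hl => ?_
  rw [coeff_C_mul, coeff_eq_zero_of_natDegree_lt, mul_zero]
  exact (natDegree_jacobiPoly_le a b l).trans_lt ((Finset.mem_range.mp hl).trans_le hk)

/-! ### Cardinal functions of the fractional integral. -/

/-- The polynomial of degree `< #s` whose fractional integral is the `j`-th cardinal function of the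
points `y i`, `i ∈ s`. -/
noncomputable def fracCardinal {ι : Type*} [DecidableEq ι] {ρ : ℝ} (h0 : -1 < -ρ) (h1 : -1 < ρ)
    (s : Finset ι) (y : ι → ℝ) (j : ι) : ℝ[X] :=
  ∑ l ∈ Finset.range s.card, C (1 / (1 + y j) ^ ρ * (Real.Gamma (l + 1 + ρ) / (l.factorial : ℝ) *
    (1 / jacobiGamma (-ρ) ρ l *
      jacobiIntegral h0 h1 (jacobiPoly (-ρ) ρ l * Lagrange.basis s y j)))) * legendrePoly l

theorem degree_fracCardinal_lt {ι : Type*} [DecidableEq ι] {ρ : ℝ} (h0 : -1 < -ρ) (h1 : -1 < ρ)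
    (s : Finset ι) (y : ι → ℝ) (j : ι) : (fracCardinal h0 h1 s y j).degree < s.card :=
  degree_sum_C_mul_jacobiPoly_lt 0 0 _ _

theorem degree_basis_lt {ι : Type*} [DecidableEq ι] {s : Finset ι} {y : ι → ℝ}
    (hy : Set.InjOn y s) {j : ι} (hj : j ∈ s) : (Lagrange.basis s y j).degree < s.card := by
  rw [Lagrange.degree_basis hy hj]
  exact_mod_cast Nat.sub_lt (Finset.card_pos.mpr ⟨j, hj⟩) one_pos

/-- The fractional integral of `f` is `(1+t)^ρ g` with `deg g < #s`. The conditions say that `g`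
agrees with `L_j/(1+y_j)^ρ` at `#s` distinct points, hence everywhere; orthogonality then reads off
the Legendre coefficients of `f`. -/
theorem leftFracIntegral_eq_ite_iff {ι : Type*} [DecidableEq ι] {ρ : ℝ} (hρ : 0 < ρ) (hρ1 : ρ < 1)
    (h0 : -1 < -ρ) (h1 : -1 < ρ)
    {s : Finset ι} {y : ι → ℝ} (hy : Set.InjOn y s) (hy1 : ∀ i ∈ s, -1 < y i) {j : ι} (hj : j ∈ s)
    {f : ℝ[X]} (hf : f.degree < s.card) :
    (∀ i ∈ s, leftFracIntegral ρ (fun t => f.eval t) (y i) = if i = j then 1 else 0)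
      ↔ f = fracCardinal h0 h1 s y j := by
  have hΓ : ∀ l : ℕ, Real.Gamma ((l : ℝ) + 1 + ρ) ≠ 0 := fun l =>
    (Real.Gamma_pos_of_pos (by positivity)).ne'
  have hpos : ∀ i ∈ s, (1 + y i) ^ ρ ≠ 0 := fun i hi =>
    (Real.rpow_pos_of_pos (by linarith [hy1 i hi]) ρ).ne'
  have hL := degree_basis_lt hy hj
  constructor
  · intro h
    obtain ⟨c, hc⟩ := exists_eq_sum_jacobiPoly (a := 0) (b := 0) (by norm_num) (by norm_num) _ f hf
    change f = ∑ l ∈ Finset.range s.card, C (c l) * legendrePoly l at hc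
    have hg : ∑ l ∈ Finset.range s.card,
        C (c l * (l.factorial / Real.Gamma (l + 1 + ρ))) * jacobiPoly (-ρ) ρ l
        = C (1 / (1 + y j) ^ ρ) * Lagrange.basis s y j := by
      refine Polynomial.eq_of_degrees_lt_of_eval_index_eq s hy
        (degree_sum_C_mul_jacobiPoly_lt _ _ _ _) ?_ fun i hi => ?_
      · rw [degree_C_mul (one_div_ne_zero (hpos j hj))]; exact hL
      · have := h i hi
        rw [hc, leftFracIntegral_sum_legendrePoly hρ hρ1 (hy1 i hi)] at this
        rw [eval_mul, eval_C]
        refine mul_left_cancel₀ (hpos i hi) (this.trans ?_)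
        split_ifs with hij
        · subst hij
          rw [Lagrange.eval_basis_self hy hi]
          field_simp [hpos i hi]
        · rw [Lagrange.eval_basis_of_ne (Ne.symm hij) hi]; ring
    rw [fracCardinal]
    conv_lhs => rw [hc]
    refine Finset.sum_congr rfl fun l hl => ?_
    have hγ := (jacobiGamma_pos h0 h1 l).ne'
    -- Pairing `g` with `P_l^{(-ρ,ρ)}` isolates the `l`-th coefficient.
    have := jacobiIntegral_jacobiPoly_sum h0 h1 (Finset.mem_range.mp hl)
      (fun l : ℕ => c l * (l.factorial / Real.Gamma (l + 1 + ρ)))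
    rw [hg, mul_left_comm, jacobiIntegral_C_mul] at this
    congr 2
    calc c l = Real.Gamma (l + 1 + ρ) / l.factorial * (1 / jacobiGamma (-ρ) ρ l)
          * (c l * (l.factorial / Real.Gamma (l + 1 + ρ)) * jacobiGamma (-ρ) ρ l) := by
            have := hΓ l
            field_simp
      _ = _ := by rw [← this]; ring
  · rintro rfl i hi
    have e : ∑ l ∈ Finset.range s.card, C (1 / (1 + y j) ^ ρ * (Real.Gamma (l + 1 + ρ) /
        (l.factorial : ℝ) * (1 / jacobiGamma (-ρ) ρ l *
          jacobiIntegral h0 h1 (jacobiPoly (-ρ) ρ l * Lagrange.basis s y j)))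
          * (l.factorial / Real.Gamma (l + 1 + ρ))) * jacobiPoly (-ρ) ρ l
        = C (1 / (1 + y j) ^ ρ) * Lagrange.basis s y j := by
      conv_rhs => rw [eq_sum_jacobiPoly h0 h1 hL]
      rw [Finset.mul_sum]
      refine Finset.sum_congr rfl fun l _ => ?_
      rw [← mul_assoc (C _) (C _), ← C_mul]
      congr 2
      have := hΓ l
      field_simp
    rw [fracCardinal, leftFracIntegral_sum_legendrePoly hρ hρ1 (hy1 i hi), e, eval_mul, eval_C]
    split_ifs with hij
    · subst hij
      rw [Lagrange.eval_basis_self hy hi]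
      field_simp [hpos i hi]
    · rw [Lagrange.eval_basis_of_ne (Ne.symm hij) hi]; ring

/-! ### Positivity and the location of the nodes. -/

/-- By Parseval: a sum of squares with positive weights vanishes only if every coefficient does. -/
theorem jacobiIntegral_mul_self_pos {a b : ℝ} (ha : -1 < a) (hb : -1 < b) {q : ℝ[X]} (hq : q ≠ 0) :
    0 < jacobiIntegral ha hb (q * q) := by
  set m := q.natDegree with hm
  have hdeg : q.degree < ((m + 1 : ℕ) : WithBot ℕ) :=
    degree_le_natDegree.trans_lt (by exact_mod_cast Nat.lt_succ_self _)
  obtain ⟨c, hc⟩ := exists_eq_sum_jacobiPoly ha hb _ q hdeg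
  have e : jacobiIntegral ha hb (q * q)
      = ∑ n ∈ Finset.range (m + 1), c n ^ 2 * jacobiGamma a b n := by
    conv_lhs => arg 2; arg 1; rw [hc]
    rw [Finset.sum_mul, map_sum]
    refine Finset.sum_congr rfl fun n hn => ?_
    rw [mul_assoc, jacobiIntegral_C_mul, hc,
      jacobiIntegral_jacobiPoly_sum ha hb (Finset.mem_range.mp hn)]
    ring
  have hγ := fun n => jacobiGamma_pos ha hb n
  rw [e]
  refine lt_of_le_of_ne (Finset.sum_nonneg fun n _ => by have := hγ n; positivity) fun h0 => hq ?_
  have h1 := (Finset.sum_eq_zero_iff_of_nonneg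
    (fun n _ => by have := hγ n; positivity)).mp h0.symm
  rw [hc]
  refine Finset.sum_eq_zero fun n hn => ?_
  have := (mul_eq_zero.mp (h1 n hn)).resolve_right (hγ n).ne'
  rw [pow_eq_zero_iff two_ne_zero] at this
  simp [this]

theorem jacobiIntegral_nonneg {a b : ℝ} (ha : -1 < a) (hb : -1 < b) {f : ℝ[X]}
    (hf : ∀ t ∈ Set.Icc (-1 : ℝ) 1, 0 ≤ f.eval t) : 0 ≤ jacobiIntegral ha hb f := by
  rw [jacobiIntegral_apply]
  refine intervalIntegral.integral_nonneg (by norm_num) fun t ht => mul_nonneg (hf t ht) ?_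
  exact mul_nonneg (Real.rpow_nonneg (by linarith [ht.2]) _) (Real.rpow_nonneg (by linarith [ht.1]) _)

theorem derivative_jacobiPoly_ne_zero {a b : ℝ} (ha : -1 < a) (hb : -1 < b) {N : ℕ} (hN : 1 ≤ N) :
    derivative (jacobiPoly a b N) ≠ 0 := by
  intro h
  have h2 := congrArg (fun p => p.coeff (N - 1)) h
  simp only [coeff_derivative, coeff_zero, Nat.sub_add_cancel hN] at h2
  have h3 := (coeff_jacobiPoly_self_pos ha hb N).ne'
  have h4 : ((N - 1 : ℕ) : ℝ) + 1 ≠ 0 := by positivity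
  exact mul_ne_zero h3 h4 h2

/-- The zeros of the derivative of a Jacobi polynomial lie in `[-1,1]`. -/
theorem mem_Icc_of_eval_derivative_jacobiPoly_eq_zero {a b : ℝ} (ha : -1 < a) (hb : -1 < b) {N : ℕ}
    (hN : 1 ≤ N) {z : ℝ} (hz : (derivative (jacobiPoly a b N)).eval z = 0) :
    z ∈ Set.Icc (-1 : ℝ) 1 := by
  obtain ⟨n, rfl⟩ := Nat.exists_eq_add_of_le' hN
  obtain ⟨q, hq⟩ := dvd_iff_isRoot.mpr hz
  have hne := derivative_jacobiPoly_ne_zero ha hb hN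
  have hq0 : q ≠ 0 := by rintro rfl; simp [hq] at hne
  have hdeg : q.degree < n := by
    have h1 : (derivative (jacobiPoly a b (n + 1))).natDegree = q.natDegree + 1 := by
      rw [hq, natDegree_mul (X_sub_C_ne_zero z) hq0, natDegree_X_sub_C, add_comm]
    have h2 := natDegree_derivative_le (jacobiPoly a b (n + 1))
    have h3 := natDegree_jacobiPoly_le a b (n + 1)
    rw [degree_eq_natDegree hq0]
    exact_mod_cast (by omega : q.natDegree < n)
  have h0 := jacobiIntegral_derivative_jacobiPoly_mul ha hb hdeg
  rw [← jacobiIntegral_add_one, hq] at h0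
  have ha' := neg_one_lt_add_one ha
  have hb' := neg_one_lt_add_one hb
  -- With `P' = (X - z) q`, orthogonality gives `∫ (t - z) q² ω^{(a+1,b+1)} = 0`. If `z` lay outside
  -- `[-1,1]`, then `t - z` would have a fixed sign bounded away from zero on the interval.
  have hpos := jacobiIntegral_mul_self_pos ha' hb' hq0
  constructor <;> by_contra! hlt
  · have e : (X - C z) * q * q = C (-1 - z) * (q * q) + (1 + X) * (q * q) := by
      simp only [C_sub, C_neg, C_1]; ring
    have h2 : 0 ≤ jacobiIntegral ha' hb' ((1 + X) * (q * q)) :=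
      jacobiIntegral_nonneg _ _ fun t ht => by
        have : 0 ≤ 1 + t := by linarith [ht.1]
        simp only [eval_mul, eval_add, eval_one, eval_X]
        exact mul_nonneg this (mul_self_nonneg _)
    rw [e, map_add, jacobiIntegral_C_mul] at h0
    have : 0 < (-1 - z) * jacobiIntegral ha' hb' (q * q) := mul_pos (by linarith) hpos
    linarith
  · have e : (X - C z) * q * q = C (1 - z) * (q * q) - (1 - X) * (q * q) := by
      simp only [C_sub, C_1]; ring
    have h2 : 0 ≤ jacobiIntegral ha' hb' ((1 - X) * (q * q)) :=
      jacobiIntegral_nonneg _ _ fun t ht => by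
        have : 0 ≤ 1 - t := by linarith [ht.2]
        simp only [eval_mul, eval_sub, eval_one, eval_X]
        exact mul_nonneg this (mul_self_nonneg _)
    rw [e, map_sub, jacobiIntegral_C_mul] at h0
    have : 0 < (z - 1) * jacobiIntegral ha' hb' (q * q) := mul_pos (by linarith) hpos
    linarith

namespace IsJGLNodes

variable {α β : ℝ} {N : ℕ} {x : Fin (N + 1) → ℝ}

theorem eval_eq_zero (hx : IsJGLNodes α β N x) (i : Fin (N + 1)) :
    (1 - x i ^ 2) * (derivative (jacobiPoly α β N)).eval (x i) = 0 := by
  have : x i ∈ Set.range x := ⟨i, rfl⟩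
  rwa [hx.range_eq] at this

theorem mem_Icc (hx : IsJGLNodes α β N x) (hα : -1 < α) (hβ : -1 < β) (hN : 1 ≤ N)
    (i : Fin (N + 1)) : x i ∈ Set.Icc (-1 : ℝ) 1 := by
  rcases mul_eq_zero.mp (hx.eval_eq_zero i) with h | h
  · have : x i ^ 2 = 1 := by linarith
    constructor <;> nlinarith
  · exact mem_Icc_of_eval_derivative_jacobiPoly_eq_zero hα hβ hN h

theorem zero_eq (hx : IsJGLNodes α β N x) (hα : -1 < α) (hβ : -1 < β) (hN : 1 ≤ N) : x 0 = -1 := by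
  have : (-1 : ℝ) ∈ Set.range x := by rw [hx.range_eq]; simp
  obtain ⟨i, hi⟩ := this
  refine le_antisymm ?_ (hx.mem_Icc hα hβ hN 0).1
  rw [← hi]
  exact hx.strictMono.monotone (Fin.zero_le i)

theorem last_eq (hx : IsJGLNodes α β N x) (hα : -1 < α) (hβ : -1 < β) (hN : 1 ≤ N) :
    x (Fin.last N) = 1 := by
  have : (1 : ℝ) ∈ Set.range x := by rw [hx.range_eq]; simp
  obtain ⟨i, hi⟩ := this
  refine le_antisymm (hx.mem_Icc hα hβ hN _).2 ?_
  rw [← hi]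
  exact hx.strictMono.monotone (Fin.le_last i)

theorem neg_one_lt (hx : IsJGLNodes α β N x) (hα : -1 < α) (hβ : -1 < β) (hN : 1 ≤ N)
    {i : Fin (N + 1)} (hi : i ≠ 0) : -1 < x i := by
  rw [← hx.zero_eq hα hβ hN]
  exact hx.strictMono (Fin.pos_iff_ne_zero.mpr hi)

theorem lt_one (hx : IsJGLNodes α β N x) (hα : -1 < α) (hβ : -1 < β) (hN : 1 ≤ N)
    {i : Fin (N + 1)} (hi : i ≠ Fin.last N) : x i < 1 := by
  rw [← hx.last_eq hα hβ hN]
  exact hx.strictMono (Fin.lt_last_iff_ne_last.mpr hi)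

theorem eval_derivative_eq_zero (hx : IsJGLNodes α β N x) (hα : -1 < α) (hβ : -1 < β) (hN : 1 ≤ N)
    {i : Fin (N + 1)} (h0 : i ≠ 0) (h1 : i ≠ Fin.last N) :
    (derivative (jacobiPoly α β N)).eval (x i) = 0 := by
  refine (mul_eq_zero.mp (hx.eval_eq_zero i)).resolve_left ?_
  have := mul_pos (sub_pos.mpr (hx.lt_one hα hβ hN h1))
    (neg_lt_iff_pos_add'.mp (hx.neg_one_lt hα hβ hN h0))
  nlinarith

end IsJGLNodes

/-! ### Exactness of Gauss–Lobatto quadrature. -/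

theorem natDegree_derivative_jacobiPoly_le (a b : ℝ) (N : ℕ) :
    (derivative (jacobiPoly a b N)).natDegree ≤ N - 1 :=
  (natDegree_derivative_le _).trans (Nat.sub_le_sub_right (natDegree_jacobiPoly_le a b N) 1)

/-- A polynomial of degree at most `#s` vanishing at the points of `s` is a multiple of
`(X - x_j) L_j`. -/
theorem eq_C_eval_derivative_mul_basis {ι : Type*} [DecidableEq ι] {s : Finset ι} {x : ι → ℝ}
    (hx : Set.InjOn x s) {j : ι} (hj : j ∈ s) {F : ℝ[X]} (hF : F.natDegree ≤ s.card)
    (h0 : ∀ i ∈ s, F.eval (x i) = 0) :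
    F = (X - C (x j)) * (C ((derivative F).eval (x j)) * Lagrange.basis s x j) := by
  obtain ⟨G, hG⟩ := dvd_iff_isRoot.mpr (h0 j hj)
  have hcard : 0 < s.card := Finset.card_pos.mpr ⟨j, hj⟩
  have hdeg : G.degree < s.card := by
    by_cases hG0 : G = 0
    · rw [hG0, degree_zero]; exact WithBot.bot_lt_coe _
    · rw [hG, natDegree_mul (X_sub_C_ne_zero _) hG0, natDegree_X_sub_C] at hF
      rw [degree_eq_natDegree hG0]
      exact_mod_cast (by omega : G.natDegree < s.card)
  have hd : (derivative F).eval (x j) = G.eval (x j) := by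
    rw [hG]; simp [derivative_mul]
  conv_lhs => rw [hG]
  congr 1
  refine eq_of_degrees_lt_of_eval_index_eq s hx hdeg ?_ fun i hi => ?_
  · rw [C_mul']
    refine (degree_smul_le _ _).trans_lt ?_
    rw [Lagrange.degree_basis hx hj]
    exact_mod_cast Nat.sub_lt hcard one_pos
  · rw [eval_mul, eval_C, hd]
    rcases eq_or_ne i j with rfl | hij
    · rw [Lagrange.eval_basis_self hx hj, mul_one]
    · rw [Lagrange.eval_basis_of_ne hij.symm hi, mul_zero]
      have := h0 i hi
      rw [hG, eval_mul] at this
      refine (mul_eq_zero.mp this).resolve_left ?_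
      simpa [sub_eq_zero] using fun h => hij (hx hi hj h)

/-- The Jacobi-Gauss-Lobatto quadrature rule is exact for polynomials of degree `< 2N`. -/
theorem IsJGLNodes.jacobiIntegral_eq_sum {α β : ℝ} {N : ℕ} {x : Fin (N + 1) → ℝ}
    (hx : IsJGLNodes α β N x) (hα : -1 < α) (hβ : -1 < β) (hN : 1 ≤ N) {f : ℝ[X]}
    (hf : f.natDegree < 2 * N) :
    jacobiIntegral hα hβ f = ∑ i, f.eval (x i) * quadWeight α β x i := by
  obtain ⟨n, rfl⟩ := Nat.exists_eq_add_of_le' hN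
  have hinj : Set.InjOn x (Finset.univ : Finset (Fin (n + 1 + 1))) := hx.strictMono.injective.injOn
  set W : ℝ[X] := (1 - X ^ 2) * derivative (jacobiPoly α β (n + 1)) with hW
  have hW0 : W ≠ 0 := by
    refine mul_ne_zero ?_ (derivative_jacobiPoly_ne_zero hα hβ hN)
    intro h
    have := congrArg (fun p => p.eval 0) h
    simp at this
  have hWdeg : W.natDegree ≤ n + 2 := by
    have h1 := natDegree_derivative_jacobiPoly_le α β (n + 1)
    have h2 : (1 - X ^ 2 : ℝ[X]).natDegree ≤ 2 := by compute_degree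
    refine natDegree_mul_le.trans ?_
    omega
  -- The `N+1` distinct nodes are zeros of `W`, whose degree is at most `N+1`, so `W` is a nonzero
  -- constant times the nodal polynomial.
  have hdvd : Lagrange.nodal Finset.univ x ∣ W := by
    rw [Lagrange.nodal_eq]
    refine Finset.prod_dvd_of_coprime (fun i _ j _ hij => ?_) fun i _ => ?_
    · exact isCoprime_X_sub_C_of_isUnit_sub
        (sub_ne_zero.mpr (hx.strictMono.injective.ne hij)).isUnit
    · rw [dvd_iff_isRoot]
      simpa [hW] using hx.eval_eq_zero i
  obtain ⟨g, hg⟩ := hdvd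
  have hg0 : g ≠ 0 := by rintro rfl; simp at hg; exact hW0 hg
  have hgdeg : g.natDegree = 0 := by
    rw [hg, natDegree_mul (Lagrange.nodal_ne_zero) hg0, Lagrange.natDegree_nodal] at hWdeg
    simp at hWdeg
    omega
  obtain ⟨c, rfl⟩ : ∃ c, g = C c := ⟨_, eq_C_of_natDegree_eq_zero hgdeg⟩
  have hc : c ≠ 0 := by simpa using hg0
  set M := Lagrange.nodal Finset.univ x with hM
  have hMm : M.Monic := Lagrange.nodal_monic
  have hMdeg : M.natDegree = n + 2 := by rw [hM, Lagrange.natDegree_nodal]; simp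
  have hdiv := modByMonic_add_div f M
  -- Here `N = n+1`: dividing a polynomial of degree `< 2n+2` by one of degree `n+2` leaves a
  -- quotient of degree `< n`, to which `W` is orthogonal.
  have hq : jacobiIntegral hα hβ (M * (f /ₘ M)) = 0 := by
    have hqd : (f /ₘ M).degree < n := by
      rcases eq_or_ne (f /ₘ M) 0 with h | h
      · rw [h, degree_zero]; exact WithBot.bot_lt_coe _
      · have h1 := natDegree_divByMonic f hMm
        have h2 : ¬ f.degree < M.degree := by
          rwa [← divByMonic_eq_zero_iff hMm]
        have h3 : M.natDegree ≤ f.natDegree := natDegree_le_natDegree (not_lt.mp h2)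
        rw [degree_eq_natDegree h]
        exact_mod_cast (by omega : (f /ₘ M).natDegree < n)
    have h1 := jacobiIntegral_derivative_jacobiPoly_mul hα hβ hqd
    rw [← mul_assoc, ← hW, hg, mul_comm M, mul_assoc, jacobiIntegral_C_mul] at h1
    exact (mul_eq_zero.mp h1).resolve_left hc
  -- The remainder is the Lagrange interpolant of `f`, and the weights integrate it by definition.
  have hr : f %ₘ M = ∑ i, C (f.eval (x i)) * Lagrange.basis Finset.univ x i := by
    rw [← Lagrange.interpolate_apply]
    refine Lagrange.eq_interpolate_of_eval_eq _ hinj ?_ fun i _ => ?_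
    · have := degree_modByMonic_lt f hMm
      rwa [hM, Lagrange.degree_nodal, ← hM] at this
    · conv_rhs => rw [← hdiv]
      simp [hM, Lagrange.eval_nodal_at_node]
  rw [← hdiv, map_add, hq, add_zero, hr, map_sum]
  refine Finset.sum_congr rfl fun i _ => ?_
  rw [jacobiIntegral_C_mul, ← hr, hdiv]
  rfl

/-! ### Endpoint values of Lagrange polynomials and the coefficients `ξ`. -/

theorem eval_jacobiPoly_ode (a b : ℝ) (n : ℕ) (t : ℝ) :
    (1 - t ^ 2) * (derivative (derivative (jacobiPoly a b n))).eval t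
      + (b - a - (a + b + 2) * t) * (derivative (jacobiPoly a b n)).eval t
      = -(n * (n + a + b + 1)) * (jacobiPoly a b n).eval t := by
  have := congrArg (fun p => p.eval t) (jacobiOp_jacobiPoly a b n)
  simpa [jacobiOp] using this

namespace IsJGLNodes

variable {α β : ℝ} {N : ℕ} {x : Fin (N + 1) → ℝ}

/-- `F = (1-X) P'` vanishes at every node but `-1`, so `F = F'(x_j) (X - x_j) L_j`; evaluate at
`-1`. The differential equation expresses `P'(-1)` through `P(-1)` and `F'(x_j)` through `P(x_j)`.
At an interior node `F'` involves `P''`, at `x_j = 1` it is `-P'(1)`, whence the factor `α+1`. -/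
theorem eval_basis_erase_zero (hx : IsJGLNodes α β N x) (hα : -1 < α) (hβ : -1 < β) (hN : 1 ≤ N)
    {j : Fin (N + 1)} (hj : j ≠ 0) :
    (Lagrange.basis (Finset.univ.erase 0) x j).eval (-1)
      = -((if j = Fin.last N then α + 1 else 1) / (β + 1))
        * ((jacobiPoly α β N).eval (-1) / (jacobiPoly α β N).eval (x j)) := by
  have hcard : (Finset.univ.erase (0 : Fin (N + 1))).card = N := by simp
  have hN1 : (1 : ℝ) ≤ N := by exact_mod_cast hN
  -- The eigenvalue appears on both sides of the ratio and is cancelled at the end.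
  have hlam : (N : ℝ) * (N + α + β + 1) ≠ 0 := by
    have : 0 < (N : ℝ) + α + β + 1 := by linarith
    positivity
  have hb : β + 1 ≠ 0 := by linarith
  have hP0 := derivative_jacobiPoly_ne_zero hα hβ hN
  set P := jacobiPoly α β N with hP
  set F : ℝ[X] := (1 - X) * derivative P with hF
  have hF0 : F ≠ 0 := by
    refine mul_ne_zero ?_ hP0
    intro h
    have := congrArg (fun p => p.eval 0) h
    simp at this
  have hFdeg : F.natDegree ≤ (Finset.univ.erase (0 : Fin (N + 1))).card := by
    have h1 := natDegree_derivative_jacobiPoly_le α β N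
    have h2 : (1 - X : ℝ[X]).natDegree ≤ 1 := by compute_degree
    rw [hcard]
    refine natDegree_mul_le.trans ?_
    rw [← hP] at h1
    omega
  have hFx : ∀ i ∈ Finset.univ.erase (0 : Fin (N + 1)), F.eval (x i) = 0 := by
    intro i hi
    have hi0 := Finset.ne_of_mem_erase hi
    rw [hF, eval_mul]
    by_cases hl : i = Fin.last N
    · rw [hl, hx.last_eq hα hβ hN]; simp
    · rw [hx.eval_derivative_eq_zero hα hβ hN hi0 hl, mul_zero]
  have key := eq_C_eval_derivative_mul_basis (hx.strictMono.injective.injOn)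
    (Finset.mem_erase.mpr ⟨hj, Finset.mem_univ j⟩) hFdeg hFx
  have hd0 : (derivative F).eval (x j) ≠ 0 := by
    intro h
    rw [h, C_0, zero_mul, mul_zero] at key
    exact hF0 key
  have hv := congrArg (fun p => p.eval (-1)) key
  have hdF : (derivative F).eval (x j)
      = (1 - x j) * (derivative (derivative P)).eval (x j) - (derivative P).eval (x j) := by
    rw [hF]; simp [derivative_mul]; ring
  set L := (Lagrange.basis (Finset.univ.erase 0) x j).eval (-1) with hL
  simp only [eval_mul, eval_sub, eval_X, eval_C, hF, eval_one] at hv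
  rw [← hF, ← hL, hdF] at hv
  rw [hdF] at hd0
  have o1 := eval_jacobiPoly_ode α β N (-1)
  have oj := eval_jacobiPoly_ode α β N (x j)
  rw [← hP] at o1 oj
  split_ifs with hl
  · have hxj : x j = 1 := by rw [hl, hx.last_eq hα hβ hN]
    rw [hxj] at hv oj hd0 ⊢
    have h1 : P.eval 1 ≠ 0 := by
      intro h
      rw [h] at oj
      have ha : α + 1 ≠ 0 := by linarith
      have : (α + 1) * (derivative P).eval 1 = 0 := by linear_combination -oj / 2
      rcases mul_eq_zero.mp this with h | h
      · exact ha h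
      · rw [h] at hd0; simp at hd0
    field_simp
    refine mul_left_cancel₀ hlam ?_
    linear_combination L * (β + 1) * oj - (β + 1) * (α + 1) * hv + (α + 1) * o1
  · have hxj := hx.eval_derivative_eq_zero hα hβ hN hj hl
    rw [← hP] at hxj
    have hneg := hx.neg_one_lt hα hβ hN hj
    rw [hxj] at hv hd0 oj
    have h1 : P.eval (x j) ≠ 0 := by
      intro h
      rw [h] at oj
      apply hd0
      have : (1 + x j) * ((1 - x j) * (derivative (derivative P)).eval (x j) - 0) = 0 := by
        linear_combination oj
      exact (mul_eq_zero.mp this).resolve_left (by linarith)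
    field_simp
    refine mul_left_cancel₀ hlam ?_
    linear_combination (β + 1) * L * oj + o1 - (β + 1) * hv

/-- The same argument with `P'` itself, which vanishes exactly at the interior nodes needed: `P' =
P''(x_j) (X - x_j) L_j`, evaluated at both endpoints. -/
theorem eval_basis_interior (hx : IsJGLNodes α β N x) (hα : -1 < α) (hβ : -1 < β) (hN : 1 ≤ N)
    {j : Fin (N + 1)} (hj : j ≠ 0) (hj1 : j ≠ Fin.last N) :
    (Lagrange.basis ((Finset.univ.erase 0).erase (Fin.last N)) x j).eval (-1)
      = (x j - 1) * (jacobiPoly α β N).eval (-1)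
        / (2 * (β + 1) * (jacobiPoly α β N).eval (x j)) ∧
    (Lagrange.basis ((Finset.univ.erase 0).erase (Fin.last N)) x j).eval 1
      = -((1 + x j) * (jacobiPoly α β N).eval 1
        / (2 * (α + 1) * (jacobiPoly α β N).eval (x j))) := by
  have hlast : Fin.last N ≠ 0 := by
    rw [Ne, Fin.ext_iff, Fin.val_last, Fin.val_zero]; omega
  have hcard : ((Finset.univ.erase (0 : Fin (N + 1))).erase (Fin.last N)).card = N - 1 := by
    rw [Finset.card_erase_of_mem (Finset.mem_erase.mpr ⟨hlast, Finset.mem_univ _⟩)]; simp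
  have hN1 : (1 : ℝ) ≤ N := by exact_mod_cast hN
  have hlam : (N : ℝ) * (N + α + β + 1) ≠ 0 := by
    have : 0 < (N : ℝ) + α + β + 1 := by linarith
    positivity
  have hb : β + 1 ≠ 0 := by linarith
  have ha : α + 1 ≠ 0 := by linarith
  have hP0 := derivative_jacobiPoly_ne_zero hα hβ hN
  have key := eq_C_eval_derivative_mul_basis (s := (Finset.univ.erase 0).erase (Fin.last N))
    (hx.strictMono.injective.injOn)
    (Finset.mem_erase.mpr ⟨hj1, Finset.mem_erase.mpr ⟨hj, Finset.mem_univ j⟩⟩)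
    (hcard ▸ natDegree_derivative_jacobiPoly_le α β N)
    (fun i hi => hx.eval_derivative_eq_zero hα hβ hN
      (Finset.ne_of_mem_erase (Finset.mem_of_mem_erase hi)) (Finset.ne_of_mem_erase hi))
  set P := jacobiPoly α β N with hP
  have hd0 : (derivative (derivative P)).eval (x j) ≠ 0 := by
    intro h
    rw [h, C_0, zero_mul, mul_zero] at key
    exact hP0 key
  have hv := congrArg (fun p => p.eval (-1)) key
  have hw := congrArg (fun p => p.eval 1) key
  simp only [eval_mul, eval_sub, eval_X, eval_C] at hv hw
  have o1 := eval_jacobiPoly_ode α β N (-1)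
  have o2 := eval_jacobiPoly_ode α β N 1
  have oj := eval_jacobiPoly_ode α β N (x j)
  have hxj := hx.eval_derivative_eq_zero hα hβ hN hj hj1
  rw [← hP] at o1 o2 oj hxj
  have hneg := hx.neg_one_lt hα hβ hN hj
  have hlt := hx.lt_one hα hβ hN hj1
  rw [hxj, mul_zero, add_zero] at oj
  have h1 : P.eval (x j) ≠ 0 := by
    intro h
    rw [h, mul_zero] at oj
    have : (1 - x j ^ 2) ≠ 0 := by nlinarith
    exact (mul_ne_zero this hd0) oj
  constructor
  · field_simp
    refine mul_left_cancel₀ hlam ?_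
    generalize (Lagrange.basis _ x j).eval (-1) = L at *
    linear_combination 2 * (β + 1) * L * oj - (x j - 1) * o1 - 2 * (β + 1) * (1 - x j) * hv
  · field_simp
    refine mul_left_cancel₀ hlam ?_
    generalize (Lagrange.basis _ x j).eval 1 = L at *
    linear_combination 2 * (α + 1) * L * oj + (1 + x j) * o2 + 2 * (α + 1) * (1 + x j) * hw

/-- The product has degree at most `2N-2`, so the quadrature is exact. `L_j` vanishes at every node
except `x_j` and the omitted `x_0`. -/
theorem xiOne_eq (hx : IsJGLNodes α β N x) (hα : -1 < α) (hβ : -1 < β) (hN : 1 ≤ N)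
    {j : Fin (N + 1)} (hj : j ≠ 0) {n : ℕ} (hn : n < N) :
    xiOne α β x n j = 1 / jacobiGamma α β n * jacobiIntegral hα hβ
      (jacobiPoly α β n * Lagrange.basis (Finset.univ.erase 0) x j) := by
  have hinj : Set.InjOn x (Finset.univ.erase (0 : Fin (N + 1))) :=
    hx.strictMono.injective.injOn
  have hmem : j ∈ Finset.univ.erase (0 : Fin (N + 1)) :=
    Finset.mem_erase.mpr ⟨hj, Finset.mem_univ j⟩
  have hdeg : (jacobiPoly α β n * Lagrange.basis (Finset.univ.erase 0) x j).natDegree < 2 * N := by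
    refine natDegree_mul_le.trans_lt ?_
    rw [Lagrange.natDegree_basis hinj hmem]
    have := natDegree_jacobiPoly_le α β n
    simp only [Finset.card_erase_of_mem (Finset.mem_univ _), Finset.card_univ, Fintype.card_fin]
    omega
  rw [hx.jacobiIntegral_eq_sum hα hβ hN hdeg, Fintype.sum_eq_add 0 j hj.symm, xiOne]
  · rw [eval_mul, eval_mul, Lagrange.eval_basis_self hinj hmem, hx.zero_eq hα hβ hN,
      hx.eval_basis_erase_zero hα hβ hN hj]
    ring
  · rintro i ⟨hi0, hij⟩
    rw [eval_mul, Lagrange.eval_basis_of_ne hij.symm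
      (Finset.mem_erase.mpr ⟨hi0, Finset.mem_univ i⟩), mul_zero, zero_mul]

theorem xiTwo_eq (hx : IsJGLNodes α β N x) (hα : -1 < α) (hβ : -1 < β) (hN : 1 ≤ N)
    {j : Fin (N + 1)} (hj : j ≠ 0) (hj1 : j ≠ Fin.last N) {n : ℕ} (hn : n < N) :
    xiTwo α β x n j = 1 / jacobiGamma α β n * jacobiIntegral hα hβ
      (jacobiPoly α β n * Lagrange.basis ((Finset.univ.erase 0).erase (Fin.last N)) x j) := by
  set s := (Finset.univ.erase (0 : Fin (N + 1))).erase (Fin.last N) with hs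
  have hlast : Fin.last N ≠ 0 := by
    rw [Ne, Fin.ext_iff, Fin.val_last, Fin.val_zero]; omega
  have hinj : Set.InjOn x s := hx.strictMono.injective.injOn
  have hmem : j ∈ s := Finset.mem_erase.mpr ⟨hj1, Finset.mem_erase.mpr ⟨hj, Finset.mem_univ j⟩⟩
  have hscard : s.card ≤ N := by
    refine (Finset.card_le_card (Finset.erase_subset _ _)).trans ?_
    simp
  have hdeg : (jacobiPoly α β n * Lagrange.basis s x j).natDegree < 2 * N := by
    refine natDegree_mul_le.trans_lt ?_
    rw [Lagrange.natDegree_basis hinj hmem]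
    have := natDegree_jacobiPoly_le α β n
    omega
  rw [hx.jacobiIntegral_eq_sum hα hβ hN hdeg,
    ← Finset.sum_subset (Finset.subset_univ ({0, Fin.last N, j} : Finset (Fin (N + 1)))),
    Finset.sum_insert (by simp [hlast.symm, hj.symm]), Finset.sum_insert (by simp [hj1.symm]),
    Finset.sum_singleton, xiTwo]
  · obtain ⟨e1, e2⟩ := hx.eval_basis_interior hα hβ hN hj hj1
    rw [eval_mul, eval_mul, eval_mul, Lagrange.eval_basis_self hinj hmem, hx.zero_eq hα hβ hN,
      hx.last_eq hα hβ hN, e1, e2]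
    ring
  · intro i _ hi
    simp only [Finset.mem_insert, Finset.mem_singleton, not_or] at hi
    rw [eval_mul, Lagrange.eval_basis_of_ne (Ne.symm hi.2.2)
      (Finset.mem_erase.mpr ⟨hi.2.1, Finset.mem_erase.mpr ⟨hi.1, Finset.mem_univ i⟩⟩),
      mul_zero, zero_mul]

end IsJGLNodes

/-! ### Change of Jacobi basis. -/

theorem connectionCoeff_eq {a b : ℝ} (ha : -1 < a) (hb : -1 < b) (α β : ℝ) (l n : ℕ) :
    connectionCoeff α β a b l n
      = 1 / jacobiGamma a b l * jacobiIntegral ha hb (jacobiPoly a b l * jacobiPoly α β n) := by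
  rw [connectionCoeff, jacobiIntegral_apply]
  simp only [eval_mul]

/-- Change of basis from `P_n^{(α,β)}` to `P_l^{(a,b)}`. -/
theorem sum_connectionCoeff_mul {α β a b : ℝ} (hα : -1 < α) (hβ : -1 < β) (ha : -1 < a)
    (hb : -1 < b) {m l : ℕ} (hl : l < m) {f : ℝ[X]} (hf : f.degree < m) :
    ∑ n ∈ Finset.Icc l (m - 1), connectionCoeff α β a b l n *
        (1 / jacobiGamma α β n * jacobiIntegral hα hβ (jacobiPoly α β n * f))
      = 1 / jacobiGamma a b l * jacobiIntegral ha hb (jacobiPoly a b l * f) := by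
  conv_rhs => rw [eq_sum_jacobiPoly hα hβ hf]
  rw [Finset.mul_sum, map_sum, Finset.mul_sum]
  have hsub : Finset.Icc l (m - 1) ⊆ Finset.range m := by
    intro n hn
    rw [Finset.mem_Icc] at hn
    rw [Finset.mem_range]; omega
  rw [← Finset.sum_subset hsub]
  · refine Finset.sum_congr rfl fun n _ => ?_
    rw [connectionCoeff_eq ha hb, mul_left_comm (jacobiPoly a b l), jacobiIntegral_C_mul]
    ring
  -- The terms with `n < l` vanish because `P_l^{(a,b)}` is orthogonal to lower degrees; hence the
  -- sum starts at `l`.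
  · intro n hn hn'
    have hnl : n < l := by
      rw [Finset.mem_range] at hn
      rw [Finset.mem_Icc] at hn'
      omega
    rw [mul_left_comm (jacobiPoly a b l), jacobiIntegral_C_mul, jacobiIntegral_jacobiPoly_mul_of_degree_lt ha hb,
      mul_zero, mul_zero]
    exact degree_le_natDegree.trans_lt
      (by exact_mod_cast (natDegree_jacobiPoly_le α β n).trans_lt hnl)

/-! ### Recovering a polynomial from its first or second derivative. -/

theorem iteratedDeriv_eval (p : ℝ[X]) (k : ℕ) :
    iteratedDeriv k (fun t => p.eval t) = fun t => (derivative^[k] p).eval t := by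
  induction k generalizing p with
  | zero => simp
  | succ k ih =>
    have : deriv (fun t => p.eval t) = fun t => (derivative p).eval t := by
      ext t; exact p.deriv
    rw [iteratedDeriv_succ', this, ih, Function.iterate_succ_apply]

theorem natDegree_lt_of_degree_lt_natCast {p : ℝ[X]} {n : ℕ} (h : p.degree < n) (hn : n ≠ 0) :
    p.natDegree < n := by
  rcases eq_or_ne p 0 with rfl | hp
  · simpa using Nat.pos_of_ne_zero hn
  · exact (natDegree_lt_iff_degree_lt hp).mpr h

theorem exists_antiderivative (f : ℝ[X]) : ∃ A : ℝ[X], derivative A = f ∧ A.eval (-1) = 0 ∧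
    A.natDegree ≤ f.natDegree + 1 := by
  set B : ℝ[X] := ∑ k ∈ Finset.range (f.natDegree + 1), monomial (k + 1) (f.coeff k / (k + 1))
    with hB
  refine ⟨B - C (B.eval (-1)), ?_, by simp, ?_⟩
  · rw [derivative_sub, derivative_C, sub_zero, hB, derivative_sum]
    conv_rhs => rw [f.as_sum_range]
    refine Finset.sum_congr rfl fun k _ => ?_
    rw [derivative_monomial, Nat.add_sub_cancel]
    congr 1
    push_cast
    have : (k : ℝ) + 1 ≠ 0 := by positivity
    field_simp
  · rw [natDegree_sub_C]
    refine natDegree_sum_le_of_forall_le _ _ fun k hk => (natDegree_monomial_le _).trans ?_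
    have := Finset.mem_range.mp hk
    omega

theorem eq_zero_of_derivative_eq_zero_of_eval {p : ℝ[X]} {z : ℝ} (hp : derivative p = 0)
    (hz : p.eval z = 0) : p = 0 := by
  have h := eq_C_of_derivative_eq_zero hp
  rw [h, eval_C] at hz
  rw [h, hz, C_0]

theorem eval_eq_integral_of_derivative_eq_sum {A : ℝ[X]} (hA : A.eval (-1) = 0) (m : ℕ) (c : ℕ → ℝ)
    (P : ℕ → ℝ[X]) (h : derivative A = ∑ l ∈ Finset.range m, C (c l) * P l) (s : ℝ) :
    A.eval s = ∑ l ∈ Finset.range m, c l * ∫ t in (-1 : ℝ)..s, (P l).eval t := by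
  have h1 := intervalIntegral.integral_eq_sub_of_hasDerivAt (a := -1) (b := s)
    (fun t _ => A.hasDerivAt t) ((derivative A).continuous.intervalIntegrable _ _)
  rw [hA, sub_zero] at h1
  rw [← h1, h]
  simp only [eval_finsetSum, eval_mul, eval_C]
  rw [intervalIntegral.integral_finsetSum]
  · exact Finset.sum_congr rfl fun l _ => intervalIntegral.integral_const_mul _ _
  · intro l _
    exact Continuous.intervalIntegrable (by fun_prop) _ _

theorem integral_sub_mul_derivative_derivative (A : ℝ[X]) (s z : ℝ) :
    ∫ t in (-1 : ℝ)..s, (z - t) * (derivative (derivative A)).eval t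
      = (z - s) * (derivative A).eval s + A.eval s
        - ((z + 1) * (derivative A).eval (-1) + A.eval (-1)) := by
  have h1 := intervalIntegral.integral_eq_sub_of_hasDerivAt (a := -1) (b := s)
    (f := fun t => (z - t) * (derivative A).eval t + A.eval t)
    (f' := fun t => (z - t) * (derivative (derivative A)).eval t) (fun t _ => by
      refine ((((hasDerivAt_id t).const_sub z).mul ((derivative A).hasDerivAt t)).add
        (A.hasDerivAt t)).congr_deriv ?_
      simp) (Continuous.intervalIntegrable (by fun_prop) _ _)
  rw [h1, sub_neg_eq_add]

theorem integral_sub_mul_sum (m : ℕ) (c : ℕ → ℝ) (P : ℕ → ℝ[X]) (s z : ℝ) :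
    ∫ t in (-1 : ℝ)..s, (z - t) * (∑ l ∈ Finset.range m, C (c l) * P l).eval t
      = ∑ l ∈ Finset.range m, c l * ∫ t in (-1 : ℝ)..s, (z - t) * (P l).eval t := by
  simp only [eval_finsetSum, eval_mul, eval_C, Finset.mul_sum]
  rw [intervalIntegral.integral_finsetSum]
  · refine Finset.sum_congr rfl fun l _ => ?_
    rw [← intervalIntegral.integral_const_mul]
    congr 1; ext t; ring
  · intro l _
    exact Continuous.intervalIntegrable (by fun_prop) _ _

theorem phiBasis_eq (l : ℕ) (s : ℝ) : phiBasis l s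
    = -((1 + s) / 2) * (∫ t in (-1 : ℝ)..1, (1 - t) * (legendrePoly l).eval t)
      + ∫ t in (-1 : ℝ)..s, (s - t) * (legendrePoly l).eval t := by
  rw [phiBasis, neg_mul, ← mul_neg, ← intervalIntegral.integral_neg]
  congr 3; ext t; ring

/-- Taylor's formula at `-1` with integral remainder, with the unknown `A'(-1)` eliminated by `A(1)
= 0`; this produces the linear correction in `phiBasis`. -/
theorem eval_eq_sum_phiBasis {A : ℝ[X]} (hA : A.eval (-1) = 0) (hA1 : A.eval 1 = 0) (m : ℕ)
    (c : ℕ → ℝ)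
    (h : derivative (derivative A) = ∑ l ∈ Finset.range m, C (c l) * legendrePoly l) (s : ℝ) :
    A.eval s = ∑ l ∈ Finset.range m, c l * phiBasis l s := by
  have h1 := integral_sub_mul_derivative_derivative A s s
  have h2 := integral_sub_mul_derivative_derivative A 1 1
  rw [h, integral_sub_mul_sum] at h1 h2
  rw [hA] at h1 h2
  rw [hA1] at h2
  simp only [phiBasis_eq, mul_add, Finset.sum_add_distrib, h1]
  simp only [mul_left_comm (c _) (-((1 + s) / 2)), ← Finset.mul_sum, h2]
  ring

/-! ### Order `μ ∈ (0,1)`. -/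

section One

variable {α β : ℝ} {N : ℕ} {x : Fin (N + 1) → ℝ} {μ : ℝ}

/-- The first-order conditions on `Q_j`, `j ≠ 0`, determine the derivative of `Q_j`. -/
theorem IsJGLNodes.caputoDeriv_one_iff (hx : IsJGLNodes α β N x) (hα : -1 < α) (hβ : -1 < β)
    (hN : 1 ≤ N) (hμ : 0 < μ) (hμ1 : μ < 1) (h0 : -1 < -(1 - μ)) (h1 : -1 < 1 - μ)
    {j : Fin (N + 1)} (hj : j ≠ 0) {q : ℝ[X]}
    (hq : q.natDegree ≤ N) :
    (∀ i, i ≠ 0 → caputoDeriv 1 μ (fun t => q.eval t) (x i) = if i = j then 1 else 0)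
      ↔ derivative q = fracCardinal h0 h1 (Finset.univ.erase 0) x j := by
  have hcard : (Finset.univ.erase (0 : Fin (N + 1))).card = N := by simp
  rw [← leftFracIntegral_eq_ite_iff (by linarith) (by linarith) h0 h1
    (hx.strictMono.injective.injOn) (fun i hi => hx.neg_one_lt hα hβ hN (Finset.ne_of_mem_erase hi))
    (Finset.mem_erase.mpr ⟨hj, Finset.mem_univ j⟩)]
  · simp only [caputoDeriv, iteratedDeriv_eval, Finset.mem_erase, Finset.mem_univ, and_true,
      Function.iterate_one, Nat.cast_one, ne_eq]
  · rw [hcard]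
    refine degree_le_natDegree.trans_lt ?_
    have := natDegree_derivative_le q
    exact_mod_cast (by omega : (derivative q).natDegree < N)

theorem IsJGLNodes.fracCardinal_erase_zero (hx : IsJGLNodes α β N x) (hα : -1 < α) (hβ : -1 < β)
    (hN : 1 ≤ N) (h0 : -1 < -(1 - μ)) (h1 : -1 < 1 - μ) {j : Fin (N + 1)} (hj : j ≠ 0) :
    fracCardinal h0 h1 (Finset.univ.erase 0) x j = ∑ l ∈ Finset.range N,
      C (1 / (1 + x j) ^ (1 - μ) *
        (Real.Gamma (l - μ + 2) / (l.factorial : ℝ) * xiBreveOne α β μ x l j)) * legendrePoly l := by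
  have hcard : (Finset.univ.erase (0 : Fin (N + 1))).card = N := by simp
  have hdeg := degree_basis_lt (s := Finset.univ.erase (0 : Fin (N + 1)))
    hx.strictMono.injective.injOn (Finset.mem_erase.mpr ⟨hj, Finset.mem_univ j⟩)
  rw [fracCardinal]
  rw [hcard] at hdeg ⊢
  refine Finset.sum_congr rfl fun l hl => ?_
  rw [← sum_connectionCoeff_mul hα hβ h0 h1 (Finset.mem_range.mp hl) hdeg, xiBreveOne,
    show (l : ℝ) + 1 + (1 - μ) = l - μ + 2 by ring, neg_sub]
  congr 4
  refine Finset.sum_congr rfl fun n hn => ?_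
  rw [hx.xiOne_eq hα hβ hN hj (by rw [Finset.mem_Icc] at hn; omega)]

/-- `Q_j` is the antiderivative of `fracCardinal` that vanishes at `-1`. The nodal conditions fix
the derivative and the value at `-1` fixes the constant. -/
theorem IsJGLNodes.existsUnique_caputoBirkhoffOne (hx : IsJGLNodes α β N x) (hα : -1 < α)
    (hβ : -1 < β) (hN : 1 ≤ N) (hμ : 0 < μ) (hμ1 : μ < 1) :
    ∃! Q : Fin (N + 1) → ℝ[X], IsCaputoBirkhoffBasisOne μ x Q := by
  have h0 : -1 < -(1 - μ) := by linarith
  have h1 : -1 < 1 - μ := by linarith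
  have hdeg : ∀ j, (fracCardinal h0 h1 (Finset.univ.erase 0) x j).natDegree + 1 ≤ N := fun j => by
    have h := degree_fracCardinal_lt h0 h1 (Finset.univ.erase 0) x j
    have hcard : (Finset.univ.erase (0 : Fin (N + 1))).card = N := by simp
    rw [hcard] at h
    exact natDegree_lt_of_degree_lt_natCast h (by omega)
  choose A hA hA0 hAd using fun j =>
    exists_antiderivative (fracCardinal h0 h1 (Finset.univ.erase 0) x j)
  refine ⟨fun j => if j = 0 then 1 else A j, ⟨fun j => ?_, by simp, fun j hj => ?_,
    fun j hj => ?_⟩, fun R hR => ?_⟩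
  · split_ifs
    · simp
    · exact (hAd j).trans (hdeg j)
  · simp [hj, hA0]
  · simp only [if_neg hj]
    exact (hx.caputoDeriv_one_iff hα hβ hN hμ hμ1 h0 h1 hj ((hAd j).trans (hdeg j))).mpr (hA j)
  · ext1 j
    split_ifs with hj
    · rw [hj, hR.zero_eq]
    · rw [← sub_eq_zero]
      refine eq_zero_of_derivative_eq_zero_of_eval (z := -1) ?_ ?_
      · rw [derivative_sub, hA, (hx.caputoDeriv_one_iff hα hβ hN hμ hμ1 h0 h1 hj
          (hR.degree_le j)).mp (hR.caputo_eq j hj), sub_self]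
      · rw [eval_sub, hA0, hR.eval_neg_one j hj, sub_self]

end One

/-! ### Order `μ ∈ (1,2)`. -/

section Two

variable {α β : ℝ} {N : ℕ} {x : Fin (N + 1) → ℝ} {μ : ℝ}

theorem Fin.last_ne_zero_of_one_le (hN : 1 ≤ N) : Fin.last N ≠ 0 := by
  rw [Ne, Fin.ext_iff, Fin.val_last, Fin.val_zero]; omega

theorem Fin.card_univ_erase_zero_erase_last (hN : 1 ≤ N) :
    ((Finset.univ.erase (0 : Fin (N + 1))).erase (Fin.last N)).card = N - 1 := by
  rw [Finset.card_erase_of_mem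
    (Finset.mem_erase.mpr ⟨Fin.last_ne_zero_of_one_le hN, Finset.mem_univ _⟩)]
  simp

/-- For `N = 1` there are no interior indices; this keeps the subtractions `N - 1` and `N - 2` from
truncating. -/
theorem Fin.two_le_of_ne_zero_of_ne_last {j : Fin (N + 1)} (hj : j ≠ 0) (hj1 : j ≠ Fin.last N) :
    2 ≤ N := by
  have h2 : (j : ℕ) ≠ 0 := fun h => hj (Fin.ext h)
  have h3 : (j : ℕ) ≠ N := fun h => hj1 (Fin.ext h)
  have := j.isLt
  omega

/-- The second-order conditions on an interior `Q_j` determine the second derivative of `Q_j`. -/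
theorem IsJGLNodes.caputoDeriv_two_iff (hx : IsJGLNodes α β N x) (hα : -1 < α) (hβ : -1 < β)
    (hN : 1 ≤ N) (hμ : 1 < μ) (hμ1 : μ < 2) (h0 : -1 < -(2 - μ)) (h1 : -1 < 2 - μ)
    {j : Fin (N + 1)} (hj : j ≠ 0) (hj1 : j ≠ Fin.last N) {q : ℝ[X]} (hq : q.natDegree ≤ N) :
    (∀ i, i ≠ 0 → i ≠ Fin.last N →
        caputoDeriv 2 μ (fun t => q.eval t) (x i) = if i = j then 1 else 0)
      ↔ derivative (derivative q)
        = fracCardinal h0 h1 ((Finset.univ.erase 0).erase (Fin.last N)) x j := by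
  have hN2 := Fin.two_le_of_ne_zero_of_ne_last hj hj1
  rw [← leftFracIntegral_eq_ite_iff (by linarith) (by linarith) h0 h1
    (hx.strictMono.injective.injOn) (fun i hi => hx.neg_one_lt hα hβ hN
      (Finset.ne_of_mem_erase (Finset.mem_of_mem_erase hi)))
    (Finset.mem_erase.mpr ⟨hj1, Finset.mem_erase.mpr ⟨hj, Finset.mem_univ j⟩⟩)]
  · simp only [caputoDeriv, iteratedDeriv_eval, Finset.mem_erase, Finset.mem_univ, and_true,
      and_imp]
    exact ⟨fun h i h1 h0 => h i h0 h1, fun h i h0 h1 => h i h1 h0⟩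
  · rw [Fin.card_univ_erase_zero_erase_last hN]
    refine degree_le_natDegree.trans_lt ?_
    have h2 := natDegree_derivative_le q
    have h3 := natDegree_derivative_le (derivative q)
    exact_mod_cast (by omega : (derivative (derivative q)).natDegree < N - 1)

theorem IsJGLNodes.fracCardinal_interior (hx : IsJGLNodes α β N x) (hα : -1 < α) (hβ : -1 < β)
    (hN : 1 ≤ N) (h0 : -1 < -(2 - μ)) (h1 : -1 < 2 - μ) {j : Fin (N + 1)} (hj : j ≠ 0)
    (hj1 : j ≠ Fin.last N) :
    fracCardinal h0 h1 ((Finset.univ.erase 0).erase (Fin.last N)) x j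
      = ∑ l ∈ Finset.range (N - 1), C (1 / (1 + x j) ^ (2 - μ) *
        (Real.Gamma (l - μ + 3) / (l.factorial : ℝ) * xiBreveTwo α β μ x l j)) * legendrePoly l := by
  have hN2 := Fin.two_le_of_ne_zero_of_ne_last hj hj1
  have hdeg := degree_basis_lt (s := (Finset.univ.erase (0 : Fin (N + 1))).erase (Fin.last N))
    hx.strictMono.injective.injOn
    (Finset.mem_erase.mpr ⟨hj1, Finset.mem_erase.mpr ⟨hj, Finset.mem_univ j⟩⟩)
  rw [fracCardinal]
  rw [Fin.card_univ_erase_zero_erase_last hN] at hdeg ⊢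
  refine Finset.sum_congr rfl fun l hl => ?_
  rw [← sum_connectionCoeff_mul hα hβ h0 h1 (Finset.mem_range.mp hl) hdeg, xiBreveTwo,
    show (l : ℝ) + 1 + (2 - μ) = l - μ + 3 by ring, neg_sub, Nat.sub_sub]
  congr 4
  refine Finset.sum_congr rfl fun n hn => ?_
  rw [hx.xiTwo_eq hα hβ hN hj hj1 (by rw [Finset.mem_Icc] at hn; omega)]

theorem exists_second_antiderivative (f : ℝ[X]) : ∃ A : ℝ[X], derivative (derivative A) = f ∧
    A.eval (-1) = 0 ∧ A.eval 1 = 0 ∧ A.natDegree ≤ f.natDegree + 2 := by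
  obtain ⟨B, hB, -, hBd⟩ := exists_antiderivative f
  obtain ⟨D, hD, hD0, hDd⟩ := exists_antiderivative B
  -- A multiple of `X + 1` corrects the value at `1` without affecting the value at `-1` or the
  -- second derivative.
  refine ⟨D - C (D.eval 1 / 2) * (X + 1), ?_, ?_, ?_, ?_⟩
  · simp [hD, hB]
  · simp [hD0]
  · simp; ring
  · refine (natDegree_sub_le _ _).trans (max_le (by omega) ?_)
    have : (C (D.eval 1 / 2) * (X + 1)).natDegree ≤ 1 := by compute_degree
    omega

theorem IsJGLNodes.existsUnique_caputoBirkhoffTwo (hx : IsJGLNodes α β N x) (hα : -1 < α)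
    (hβ : -1 < β) (hN : 1 ≤ N) (hμ : 1 < μ) (hμ1 : μ < 2) :
    ∃! Q : Fin (N + 1) → ℝ[X], IsCaputoBirkhoffBasisTwo μ x Q := by
  have h0 : -1 < -(2 - μ) := by linarith
  have h1 : -1 < 2 - μ := by linarith
  have hlast := Fin.last_ne_zero_of_one_le hN
  choose A hA hA0 hA1 hAd using fun j =>
    exists_second_antiderivative (fracCardinal h0 h1 ((Finset.univ.erase 0).erase (Fin.last N)) x j)
  have hdeg : ∀ j : Fin (N + 1), j ≠ 0 → j ≠ Fin.last N → (A j).natDegree ≤ N := fun j hj hj1 => by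
    have h := degree_fracCardinal_lt h0 h1 ((Finset.univ.erase 0).erase (Fin.last N)) x j
    have hN2 := Fin.two_le_of_ne_zero_of_ne_last hj hj1
    rw [Fin.card_univ_erase_zero_erase_last hN] at h
    have h2 := natDegree_lt_of_degree_lt_natCast h (by omega)
    have := hAd j
    omega
  have hlin : ∀ c : ℝ, (C (1 / 2) * (1 + C c * X) : ℝ[X]).natDegree ≤ N := fun c =>
    le_trans (by compute_degree) hN
  refine ⟨fun j => if j = 0 then C (1 / 2) * (1 - X) else
    if j = Fin.last N then C (1 / 2) * (1 + X) else A j, ⟨fun j => ?_, by simp, by simp [hlast],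
      fun j hj hj1 => ?_, fun j hj hj1 => ?_, fun j hj hj1 => ?_⟩, fun R hR => ?_⟩
  · split_ifs with hj hj1
    · simpa [sub_eq_add_neg] using hlin (-1)
    · simpa using hlin 1
    · exact hdeg j hj hj1
  · simp [hj, hj1, hA0]
  · simp [hj, hj1, hA1]
  · simp only [if_neg hj, if_neg hj1]
    exact (hx.caputoDeriv_two_iff hα hβ hN hμ hμ1 h0 h1 hj hj1 (hdeg j hj hj1)).mpr (hA j)
  · ext1 j
    split_ifs with hj hj1
    · rw [hj, hR.zero_eq]
    · rw [hj1, hR.last_eq]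
    · rw [← sub_eq_zero]
      have h2 : derivative (derivative (R j - A j)) = 0 := by
        rw [derivative_sub, derivative_sub, hA, (hx.caputoDeriv_two_iff hα hβ hN hμ hμ1 h0 h1 hj hj1
          (hR.degree_le j)).mp (hR.caputo_eq j hj hj1), sub_self]
      -- The difference has zero second derivative and vanishes at `±1`, so the representation by
      -- `phiBasis` with an empty sum gives zero.
      refine Polynomial.funext fun s => ?_
      rw [eval_eq_sum_phiBasis (A := R j - A j)
        (by rw [eval_sub, hA0, hR.eval_neg_one j hj hj1, sub_self])
        (by rw [eval_sub, hA1, hR.eval_one j hj hj1, sub_self]) 0 0 (by simpa using h2)]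
      simp

end Two

/-! ### The explicit formulas. -/

theorem theorem4p2 (α β : ℝ) (hα : -1 < α) (hβ : -1 < β) (N : ℕ) (hN : 1 ≤ N)
    (x : Fin (N + 1) → ℝ) (hx : IsJGLNodes α β N x) :
    (∀ μ : ℝ, 0 < μ → μ < 1 →
      (∃! Q : Fin (N + 1) → ℝ[X], IsCaputoBirkhoffBasisOne μ x Q) ∧
      ∀ Q : Fin (N + 1) → ℝ[X], IsCaputoBirkhoffBasisOne μ x Q →
        ∀ j : Fin (N + 1), j ≠ 0 → ∀ s : ℝ,
          (Q j).eval s = 1 / (1 + x j) ^ (1 - μ) *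
            ∑ l ∈ Finset.range N,
              Real.Gamma (l - μ + 2) / (l.factorial : ℝ) * xiBreveOne α β μ x l j *
                ∫ t in (-1 : ℝ)..s, (legendrePoly l).eval t) ∧
    (∀ μ : ℝ, 1 < μ → μ < 2 →
      (∃! Q : Fin (N + 1) → ℝ[X], IsCaputoBirkhoffBasisTwo μ x Q) ∧
      ∀ Q : Fin (N + 1) → ℝ[X], IsCaputoBirkhoffBasisTwo μ x Q →
        ∀ j : Fin (N + 1), j ≠ 0 → j ≠ Fin.last N → ∀ s : ℝ,
          (Q j).eval s = 1 / (1 + x j) ^ (2 - μ) *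
            ∑ l ∈ Finset.range (N - 1),
              Real.Gamma (l - μ + 3) / (l.factorial : ℝ) * xiBreveTwo α β μ x l j *
                phiBasis l s) := by
  refine ⟨fun μ hμ hμ1 => ⟨hx.existsUnique_caputoBirkhoffOne hα hβ hN hμ hμ1, ?_⟩,
    fun μ hμ hμ1 => ⟨hx.existsUnique_caputoBirkhoffTwo hα hβ hN hμ hμ1, ?_⟩⟩
  · intro Q hQ j hj s
    have h0 : -1 < -(1 - μ) := by linarith
    have h1 : -1 < 1 - μ := by linarith
    have h := (hx.caputoDeriv_one_iff hα hβ hN hμ hμ1 h0 h1 hj (hQ.degree_le j)).mp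
      (hQ.caputo_eq j hj)
    rw [hx.fracCardinal_erase_zero hα hβ hN h0 h1 hj] at h
    rw [eval_eq_integral_of_derivative_eq_sum (hQ.eval_neg_one j hj) _ _ _ h, Finset.mul_sum]
    exact Finset.sum_congr rfl fun l _ => by rw [mul_assoc]
  · intro Q hQ j hj hj1 s
    have h0 : -1 < -(2 - μ) := by linarith
    have h1 : -1 < 2 - μ := by linarith
    have h := (hx.caputoDeriv_two_iff hα hβ hN hμ hμ1 h0 h1 hj hj1 (hQ.degree_le j)).mp
      (hQ.caputo_eq j hj hj1)
    rw [hx.fracCardinal_interior hα hβ hN h0 h1 hj hj1] at h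
    rw [eval_eq_sum_phiBasis (hQ.eval_neg_one j hj hj1) (hQ.eval_one j hj hj1) _ _ h,
      Finset.mul_sum]
    exact Finset.sum_congr rfl fun l _ => by rw [mul_assoc]
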